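/- Let $G=(V,E)$ be a finite directed graph without self-loops in which every node has positive out-degree $d_{\rm out}(v)$, let $P(v,u)=\mathbf 1\{v\to u\in E\}/d_{\rm out}(v)$, and let $\alpha\in(0,1)$. For a probability vector $\sigma$ on $V$, the personalized PageRank (PPR) vector $\pi_\sigma$ is the stationary distribution of the Markov chain with transition matrix $(1-\alpha)P+\alpha\,\mathbf 1\sigma^{\mathsf T}$; write $\pi_s=\pi_{e_s}$ and $\Pi(s,t)=\pi_s(t)$. Let $l\ge 1$, let $S=\{s_1,\dots,s_l\}$ and $T=\{t_1,\dots,t_l\}$ each consist of $l$ distinct nodes, and let $\Pi(S,T)\in\mathbb R^{l\times l}$ have entries $\pi_{s_i}(t_j)$. For a matrix $A$, $\|A\|_2$ is the Euclidean operator norm, $\|A\|_F$ the Frobenius norm, and $\mathrm{srank}(A)=(\|A\|_F/\|A\|_2)^2$ (with $\mathrm{srank}(0)=0$). Let $r^s_{\max},r^t_{\max}>0$. **Algorithm FW-BW-MCMC-Many-Pair** with $w\ge1$ walks. 1. *Forward stage.* For each $s\in S$ start with $p^s=0$, $r^s=e_s$. While $\|r^s\|_1>r^s_{\max}$: choose any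 $v^*\in\arg\max_v r^s(v)/d_{\rm out}(v)$; add $(1-\alpha)r^s(v^*)/d_{\rm out}(v^*)$ to $r^s(u)$ for every out-neighbour $u$ of $v^*$; add $\alpha r^s(v^*)$ to $p^s(v^*)$ and set $r^s(v^*)=0$. 2. *Backward stage.* For $i=1,\dots,l$ in turn, with $t=t_i$, start with $p^{t}=0$, $r^{t}=e_{t}$. While $\|r^{t}\|_\infty>r^t_{\max}$: choose any $v^*\in\arg\max_v r^{t}(v)$. If $v^*=t_j$ for some $j<i$, simultaneously replace $p^{t}$ by $p^{t}+r^{t}(t_j)\,p^{t_j}$ and $r^{t}$ by $r^{t}+r^{t}(t_j)\,(r^{t_j}-e_{t_j})$. Otherwise add $(1-\alpha)r^{t}(v^*)/d_{\rm out}(u)$ to $r^{t}(u)$ for every in-neighbour $u$ of $v^*$, add $\alpha r^{t}(v^*)$ to $p^{t}(v^*)$ and set $r^{t}(v^*)=0$. 3. *Monte Carlo stage.* Let $P_S,R_S,P_T,R_T$ be the $|V|\times l$ matrices whose $j$-th columns are $p^{s_j},r^{s_j},p^{t_j},r^{t_j}$. Put $\sigma_s=r^s/\|r^s\|_1$, let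 $\Sigma$ be the matrix with rows $\sigma_{s_i}$, and let $\|\Sigma\|_{\infty,1}=\sum_{v\in V}\max_{s\in S}\sigma_s(v)$. Let $\sigma$ be one of $$\sigma_{\rm avg}(v)=\frac1l\sum_{s\in S}\sigma_s(v),\qquad \sigma_{\max}(v)=\frac{1}{\|\Sigma\|_{\infty,1}}\max_{s\in S}\sigma_s(v).$$ Sample $w$ independent pairs $(\mu_i,\nu_i)$, where $\mu_i\sim\sigma$ and $\nu_i$ is the endpoint of a random walk with transition matrix $P$ started at $\mu_i$, whose number of steps $L$ is independent of everything else with $\mathbb P[L=k]=\alpha(1-\alpha)^k$, $k\ge0$. Return $$\hat\Pi(S,T)=P_T(S,:)+P_S^{\mathsf T}R_T+\frac1w\sum_{i=1}^w R_S^{\mathsf T}\,\mathrm{diag}(1/\sigma)\,e_{\mu_i}e_{\nu_i}^{\mathsf T}R_T,$$ where $P_T(S,:)$ consists of the rows $s_1,\dots,s_l$ of $P_T$, and where $1/\sigma(v)$ is read as $0$ if $\sigma(v)=0$ (such $v$ are never sampled). **Theorem.** Let $\epsilon>0$ and $p_{\rm fail}\in(0,1)$. The forward and backward stages terminate after finitely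 many iterations, whatever maximizers are chosen. Moreover, for all results $(p^s,r^s)_{s\in S}$, $(p^t,r^t)_{t\in T}$ of these two stages and every integer $w\ge1$: if * $\sigma=\sigma_{\rm avg}$ and $\displaystyle w\ \ge\ \frac{l^2\sqrt{\mathrm{srank}(\Pi(S,T))}\,\log(2l/p_{\rm fail})\,r^s_{\max}r^t_{\max}\,(6+4\epsilon)}{3\epsilon^2}$, or * $\sigma=\sigma_{\max}$ and $\displaystyle w\ \ge\ \frac{l^{3/2}\,\|\Sigma\|_{\infty,1}\,\log(2l/p_{\rm fail})\,r^s_{\max}r^t_{\max}\,(6+4\epsilon)}{3\epsilon^2}$, then, with probability at least $1-p_{\rm fail}$ over the sampled walks, the returned estimate satisfies $$\|\Pi(S,T)-\hat\Pi(S,T)\|_2\le\epsilon\,\max\{\|\Pi(S,T)\|_2,1\}.$$ -/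

import Mathlib

set_option linter.unusedSectionVars false

namespace PPR

/-! ### While loops with nondeterministic bodies -/

section Loops

variable {X : Type*}

/-- One iteration of `while guard do body`. The body is a relation, since it may make an
arbitrary choice (here: among the maximisers in an `arg max`). -/
def WhileStep (guard : X → Prop) (body : X → X → Prop) (x y : X) : Prop :=
  guard x ∧ body x y

/-- `y` is a possible result of `while guard do body` started at `x`. -/
def WhileOutput (guard : X → Prop) (body : X → X → Prop) (x y : X) : Prop :=
  Relation.ReflTransGen (WhileStep guard body) x y ∧ ¬ guard y

/-- The loop `while guard do body` started at `x` never gets stuck and always stops after finitely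
many iterations, whatever choices are made. -/
inductive WhileTerminates (guard : X → Prop) (body : X → X → Prop) : X → Prop
  | done (x : X) : ¬ guard x → WhileTerminates guard body x
  | step (x : X) : guard x → (∃ y, body x y) →
      (∀ y, body x y → WhileTerminates guard body y) → WhileTerminates guard body x

end Loops

variable {V : Type*} [Fintype V] [DecidableEq V]

/-! ### Personalized PageRank -/

section PageRank

variable (G : Digraph V) [DecidableRel G.Adj]

/-- The set of outgoing neighbours. -/
def outNbrs (v : V) : Finset V := Finset.univ.filter fun u => G.Adj v u

/-- The out-degree. -/
def outDeg (v : V) : ℕ := (outNbrs G v).card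

/-- The transition matrix `P = D⁻¹ A` of the simple random walk. -/
noncomputable def walkMatrix : Matrix V V ℝ :=
  Matrix.of fun v u => if G.Adj v u then 1 / (outDeg G v : ℝ) else 0

/-- `σ` is a probability distribution on `V`. -/
def IsDist (σ : V → ℝ) : Prop := (∀ v, 0 ≤ σ v) ∧ ∑ v, σ v = 1

/-- The transition matrix `P_σ = (1 - α) P + α 1 σᵀ`. -/
noncomputable def pprChain (α : ℝ) (σ : V → ℝ) : Matrix V V ℝ :=
  (1 - α) • walkMatrix G + α • Matrix.vecMulVec (fun _ => 1) σ

/-- `π` is a stationary distribution of the chain with transition matrix `P_σ`. -/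
def IsPPR (α : ℝ) (σ π : V → ℝ) : Prop :=
  IsDist π ∧ Matrix.vecMul π (pprChain G α σ) = π

open Classical in
/-- Personalized PageRank `π_σ`: the stationary distribution of the chain `P_σ`
(it exists and is unique, see `isPPR_ppr` and `IsPPR.eq_ppr`). -/
noncomputable def ppr (α : ℝ) (σ : V → ℝ) : V → ℝ :=
  if h : ∃ π, IsPPR G α σ π then h.choose else 0

/-- The matrix `Π` with entries `Π(s, t) = π_s(t)`. -/
noncomputable def pprMatrix (α : ℝ) : Matrix V V ℝ :=
  Matrix.of fun s t => ppr G α (Pi.single s 1) t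

variable {G}

theorem sum_walkMatrix (hout : ∀ v, 0 < outDeg G v) (v : V) : ∑ u, walkMatrix G v u = 1 := by
  have h : (outDeg G v : ℝ) ≠ 0 := by exact_mod_cast (hout v).ne'
  simp only [walkMatrix, Matrix.of_apply]
  rw [← Finset.sum_filter, Finset.sum_const, nsmul_eq_mul]
  exact mul_one_div_cancel h

theorem walkMatrix_nonneg (v u : V) : 0 ≤ walkMatrix G v u := by
  simp only [walkMatrix, Matrix.of_apply]
  split_ifs <;> positivity

theorem sum_vecMul_walkMatrix (hout : ∀ v, 0 < outDeg G v) (x : V → ℝ) :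
    ∑ u, Matrix.vecMul x (walkMatrix G) u = ∑ v, x v := by
  simp only [Matrix.vecMul, dotProduct]
  rw [Finset.sum_comm]
  refine Finset.sum_congr rfl fun v _ => ?_
  rw [← Finset.mul_sum, sum_walkMatrix hout, mul_one]

theorem sum_abs_vecMul_walkMatrix_le (hout : ∀ v, 0 < outDeg G v) (x : V → ℝ) :
    ∑ u, |Matrix.vecMul x (walkMatrix G) u| ≤ ∑ v, |x v| := by
  rw [← sum_vecMul_walkMatrix hout (fun v => |x v|)]
  refine Finset.sum_le_sum fun u _ => ?_
  simp only [Matrix.vecMul, dotProduct]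
  refine (Finset.abs_sum_le_sum_abs _ _).trans (Finset.sum_le_sum fun v _ => ?_)
  rw [abs_mul, abs_of_nonneg (walkMatrix_nonneg v u)]

theorem vecMul_pprChain (α : ℝ) (σ x : V → ℝ) :
    Matrix.vecMul x (pprChain G α σ)
      = (1 - α) • Matrix.vecMul x (walkMatrix G) + (α * ∑ v, x v) • σ := by
  have h : Matrix.vecMul x (Matrix.vecMulVec (fun _ => (1 : ℝ)) σ) = (∑ v, x v) • σ := by
    ext u
    simp [Matrix.vecMul, dotProduct, Matrix.vecMulVec_apply, Finset.sum_mul]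
  rw [pprChain, Matrix.vecMul_add, Matrix.vecMul_smul, Matrix.vecMul_smul, h, smul_smul]

theorem eq_zero_of_eq_vecMul {α : ℝ} (hα0 : 0 < α) (hα1 : α < 1) (hout : ∀ v, 0 < outDeg G v)
    {x : V → ℝ} (hx : x = (1 - α) • Matrix.vecMul x (walkMatrix G)) : x = 0 := by
  have h1 : ∑ v, |x v| = (1 - α) * ∑ u, |Matrix.vecMul x (walkMatrix G) u| := by
    rw [Finset.mul_sum]
    refine Finset.sum_congr rfl fun v _ => ?_
    conv_lhs => rw [hx]
    rw [Pi.smul_apply, smul_eq_mul, abs_mul, abs_of_pos (by linarith)]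
  have h2 := sum_abs_vecMul_walkMatrix_le hout x
  have h3 : 0 ≤ ∑ v, |x v| := Finset.sum_nonneg fun v _ => abs_nonneg _
  have h4 : ∑ v, |x v| = 0 := by nlinarith
  ext v
  have := (Finset.sum_eq_zero_iff_of_nonneg (fun v _ => abs_nonneg (x v))).1 h4 v
    (Finset.mem_univ v)
  simpa using this

theorem IsPPR.unique {α : ℝ} (hα0 : 0 < α) (hα1 : α < 1) (hout : ∀ v, 0 < outDeg G v)
    {σ π π' : V → ℝ} (h : IsPPR G α σ π) (h' : IsPPR G α σ π') : π = π' := by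
  have e := h.2
  have e' := h'.2
  rw [vecMul_pprChain, h.1.2] at e
  rw [vecMul_pprChain, h'.1.2] at e'
  refine sub_eq_zero.1 (eq_zero_of_eq_vecMul (x := π - π') hα0 hα1 hout ?_)
  rw [Matrix.sub_vecMul, smul_sub]
  nth_rewrite 1 [← e, ← e']
  abel

theorem exists_isPPR {α : ℝ} (hα0 : 0 < α) (hα1 : α < 1) (hout : ∀ v, 0 < outDeg G v)
    {σ : V → ℝ} (hσ : IsDist σ) : ∃ π, IsPPR G α σ π := by
  let f : (V → ℝ) →ₗ[ℝ] (V → ℝ) :=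
    LinearMap.id - (1 - α) • Matrix.vecMulLinear (walkMatrix G)
  have hf : ∀ x, f x = x - (1 - α) • Matrix.vecMul x (walkMatrix G) := fun x => rfl
  have hinj : Function.Injective f := by
    rw [injective_iff_map_eq_zero]
    intro x hx
    rw [hf, sub_eq_zero] at hx
    exact eq_zero_of_eq_vecMul hα0 hα1 hout hx
  obtain ⟨π, hπ⟩ := (LinearMap.injective_iff_surjective.1 hinj) (α • σ)
  rw [hf, sub_eq_iff_eq_add] at hπ
  have hpt : ∀ v, π v = α * σ v + (1 - α) * Matrix.vecMul π (walkMatrix G) v := fun v => by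
    conv_lhs => rw [hπ]
    simp
  have hsum : ∑ v, π v = 1 := by
    have : ∑ v, π v = α * 1 + (1 - α) * ∑ v, π v := by
      conv_rhs => rw [← sum_vecMul_walkMatrix hout π, show α * 1 = α * ∑ v, σ v by rw [hσ.2]]
      rw [Finset.mul_sum, Finset.mul_sum, ← Finset.sum_add_distrib]
      exact Finset.sum_congr rfl fun v _ => hpt v
    have h0 : α * (∑ v, π v - 1) = 0 := by linarith
    rcases mul_eq_zero.1 h0 with h0 | h0
    · exact absurd h0 hα0.ne'
    · linarith
  have habs : ∑ v, |π v| ≤ 1 := by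
    have h1 : ∑ v, |π v| ≤ α * 1 + (1 - α) * ∑ v, |Matrix.vecMul π (walkMatrix G) v| := by
      rw [show α * 1 = α * ∑ v, σ v by rw [hσ.2], Finset.mul_sum, Finset.mul_sum,
        ← Finset.sum_add_distrib]
      refine Finset.sum_le_sum fun v _ => ?_
      conv_lhs => rw [hpt v]
      refine (abs_add_le _ _).trans (le_of_eq ?_)
      rw [abs_mul, abs_mul, abs_of_pos hα0, abs_of_nonneg (hσ.1 v),
        abs_of_pos (by linarith : (0 : ℝ) < 1 - α)]
    have h2 := sum_abs_vecMul_walkMatrix_le hout π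
    have h3 := mul_le_mul_of_nonneg_left h2 (by linarith : (0 : ℝ) ≤ 1 - α)
    have h4 : α * (∑ v, |π v| - 1) ≤ 0 := by linarith
    have h5 := nonpos_of_mul_nonpos_right h4 hα0
    linarith
  have hnn : ∀ v, 0 ≤ π v := by
    have h0 : ∑ v, (|π v| - π v) = 0 := by
      refine le_antisymm ?_ (Finset.sum_nonneg fun v _ => sub_nonneg.2 (le_abs_self _))
      rw [Finset.sum_sub_distrib, hsum]
      linarith
    intro v
    have := (Finset.sum_eq_zero_iff_of_nonneg
      (fun v _ => sub_nonneg.2 (le_abs_self (π v)))).1 h0 v (Finset.mem_univ v)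
    rw [← sub_eq_zero.1 this]
    exact abs_nonneg _
  refine ⟨π, ⟨hnn, hsum⟩, ?_⟩
  rw [vecMul_pprChain, hsum, mul_one]
  conv_rhs => rw [hπ]
  abel

theorem isPPR_ppr {α : ℝ} (hα0 : 0 < α) (hα1 : α < 1) (hout : ∀ v, 0 < outDeg G v)
    {σ : V → ℝ} (hσ : IsDist σ) : IsPPR G α σ (ppr G α σ) := by
  have h := exists_isPPR (G := G) hα0 hα1 hout hσ
  rw [ppr, dif_pos h]
  exact h.choose_spec

theorem IsPPR.eq_ppr {α : ℝ} (hα0 : 0 < α) (hα1 : α < 1) (hout : ∀ v, 0 < outDeg G v)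
    {σ π : V → ℝ} (hσ : IsDist σ) (h : IsPPR G α σ π) : π = ppr G α σ :=
  h.unique hα0 hα1 hout (isPPR_ppr hα0 hα1 hout hσ)

end PageRank

/-! ### The dynamic programs -/

/-- State of a dynamic program: the estimate vector `p` and the residual vector `r`. -/
@[ext] structure DPState (V : Type*) where
  p : V → ℝ
  r : V → ℝ

/-- The initial state `p = 0`, `r = e_v`. -/
def DPState.init (v : V) : DPState V := ⟨0, Pi.single v 1⟩

section DynamicPrograms

variable (G : Digraph V) [DecidableRel G.Adj] (α : ℝ)

/-- Forward update at `v`. -/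
noncomputable def pushForward (x : DPState V) (v : V) : DPState V where
  p := Function.update x.p v (x.p v + α * x.r v)
  r := fun u =>
    if u = v then 0
    else if G.Adj v u then x.r u + (1 - α) * x.r v / (outDeg G v : ℝ)
    else x.r u

/-- Loop condition `‖r‖₁ > r_max` of the forward dynamic program. -/
def ForwardGuard (rmax : ℝ) (x : DPState V) : Prop := rmax < ∑ v, |x.r v|

/-- Loop body of the forward dynamic program: an update at some `v ∈ arg max r(v) / d_out(v)`. -/
def ForwardBody (x y : DPState V) : Prop :=
  ∃ v, (∀ u, x.r u / (outDeg G u : ℝ) ≤ x.r v / (outDeg G v : ℝ)) ∧ y = pushForward G α x v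

/-- `x` is a possible result of `Approximate-PageRank(G, s, α, rmax)`. -/
def IsForwardOutput (rmax : ℝ) (s : V) (x : DPState V) : Prop :=
  WhileOutput (ForwardGuard rmax) (ForwardBody G α) (DPState.init s) x

/-- Backward update (`Extend`) at `v`. -/
noncomputable def pushBackward (x : DPState V) (v : V) : DPState V where
  p := Function.update x.p v (x.p v + α * x.r v)
  r := fun u =>
    if u = v then 0
    else if G.Adj u v then x.r u + (1 - α) * x.r v / (outDeg G u : ℝ)
    else x.r u

/-- The `Merge` update at `v`, where `y` is the result already computed for the target `v`. -/
noncomputable def merge (x : DPState V) (v : V) (y : DPState V) : DPState V where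
  p := x.p + x.r v • y.p
  r := x.r + x.r v • (y.r - Pi.single v 1)

/-- Loop condition `‖r‖_∞ > r_max` of the backward dynamic program
(the norm on `V → ℝ` is the maximum norm). -/
def BackwardGuard (rmax : ℝ) (x : DPState V) : Prop := rmax < ‖x.r‖

/-- Loop body of the backward dynamic program for the `i`-th target, `B j` being the result for the
`j`-th target: an update at some `v ∈ arg max r(v)`, which is a `Merge` if `v` is one of the
earlier targets and an `Extend` otherwise. -/
def BackwardBody {l : ℕ} (t : Fin l → V) (B : Fin l → DPState V) (i : Fin l)
    (x y : DPState V) : Prop :=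
  ∃ v, (∀ u, x.r u ≤ x.r v) ∧
    ((∃ j < i, t j = v ∧ y = merge x v (B j)) ∨
      ((∀ j < i, t j ≠ v) ∧ y = pushBackward G α x v))

/-- `B i` is a possible result for the `i`-th target in
`Approx-Cont-Many-Targets(G, {t 0, t 1, …}, α, rmax)`, given the results `B j` for `j < i`. -/
def IsBackwardOutput (rmax : ℝ) {l : ℕ} (t : Fin l → V) (B : Fin l → DPState V)
    (i : Fin l) : Prop :=
  WhileOutput (BackwardGuard rmax) (BackwardBody G α t B i) (DPState.init (t i)) (B i)

variable {G α}

theorem pushForward_pos (hα1 : α < 1) (hout : ∀ v, 0 < outDeg G v)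
    (hloop : ∀ v, ¬ G.Adj v v) {x : DPState V} (hx : (∀ v, 0 ≤ x.r v) ∧ 0 < ∑ v, x.r v) (v : V) :
    (∀ u, 0 ≤ (pushForward G α x v).r u) ∧ 0 < ∑ u, (pushForward G α x v).r u := by
  obtain ⟨h0, h1⟩ := hx
  have hα : 0 < 1 - α := by linarith
  have hnn : ∀ u, 0 ≤ (pushForward G α x v).r u := by
    intro u
    have hu := h0 u
    have hv := h0 v
    simp only [pushForward]
    split_ifs
    · exact le_rfl
    · positivity
    · exact hu
  refine ⟨hnn, ?_⟩
  by_contra hcon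
  have hz : ∀ u, (pushForward G α x v).r u = 0 := fun u =>
    (Finset.sum_eq_zero_iff_of_nonneg (fun u _ => hnn u)).1
      (le_antisymm (not_lt.1 hcon) (Finset.sum_nonneg fun u _ => hnn u)) u (Finset.mem_univ u)
  have hother : ∀ u, u ≠ v → x.r u = 0 := by
    intro u huv
    have h := hz u
    have hu := h0 u
    have hd : 0 ≤ (1 - α) * x.r v / (outDeg G v : ℝ) :=
      div_nonneg (mul_nonneg hα.le (h0 v)) (Nat.cast_nonneg _)
    simp only [pushForward, if_neg huv] at h
    split_ifs at h
    · linarith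
    · exact h
  obtain ⟨u, hu⟩ := Finset.card_pos.1 (hout v)
  have hadj : G.Adj v u := by simpa [outNbrs] using hu
  have huv : u ≠ v := fun h => hloop v (h ▸ hadj)
  have h := hz u
  simp only [pushForward, if_neg huv, if_pos hadj, hother u huv, zero_add] at h
  have hd : (outDeg G v : ℝ) ≠ 0 := by exact_mod_cast (hout v).ne'
  have hv : x.r v = 0 := by
    rcases div_eq_zero_iff.1 h with h | h
    · exact (mul_eq_zero.1 h).resolve_left hα.ne'
    · exact absurd h hd
  refine h1.ne' (Finset.sum_eq_zero fun w _ => ?_)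
  by_cases hw : w = v
  · rw [hw, hv]
  · exact hother w hw

/-- The residual vector of the forward dynamic program is nonnegative and nonzero, so that
`σ_s = r^s / ‖r^s‖₁` makes sense. -/
theorem IsForwardOutput.pos (hα1 : α < 1) (hout : ∀ v, 0 < outDeg G v)
    (hloop : ∀ v, ¬ G.Adj v v) {rmax : ℝ} {s : V} {x : DPState V}
    (h : IsForwardOutput G α rmax s x) : (∀ v, 0 ≤ x.r v) ∧ 0 < ∑ v, x.r v := by
  obtain ⟨h, -⟩ := h
  induction h with
  | refl =>
    refine ⟨fun v => ?_, by simp [DPState.init]⟩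
    simp only [DPState.init, Pi.single_apply]
    split_ifs <;> norm_num
  | tail _ hs ih =>
    obtain ⟨-, v, -, rfl⟩ := hs
    exact pushForward_pos hα1 hout hloop ih v

end DynamicPrograms

/-! ### The start distributions -/

section StartDistributions

variable {l : ℕ}

/-- The matrix `Σ` with rows `σ_{s_i} = r^{s_i} / ‖r^{s_i}‖₁`. -/
noncomputable def sigmaMatrix (F : Fin l → DPState V) : Matrix (Fin l) V ℝ :=
  Matrix.of fun i v => (F i).r v / ∑ u, |(F i).r u|

/-- `‖Σ‖_{∞,1} = ∑_v max_s σ_s(v)`. -/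
noncomputable def sigmaNorm (F : Fin l → DPState V) : ℝ :=
  ∑ v, ⨆ i, sigmaMatrix F i v

/-- `σ_avg`. -/
noncomputable def sigmaAvg (F : Fin l → DPState V) (v : V) : ℝ :=
  1 / (l : ℝ) * ∑ i, sigmaMatrix F i v

/-- `σ_max`. -/
noncomputable def sigmaMax (F : Fin l → DPState V) (v : V) : ℝ :=
  1 / sigmaNorm F * ⨆ i, sigmaMatrix F i v

theorem sigmaMatrix_isDist {F : Fin l → DPState V}
    (hF : ∀ i, (∀ v, 0 ≤ (F i).r v) ∧ 0 < ∑ v, (F i).r v) (i : Fin l) :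
    IsDist (sigmaMatrix F i) := by
  have h : ∑ u, |(F i).r u| = ∑ u, (F i).r u :=
    Finset.sum_congr rfl fun u _ => abs_of_nonneg ((hF i).1 u)
  simp only [IsDist, sigmaMatrix, Matrix.of_apply, h]
  refine ⟨fun v => div_nonneg ((hF i).1 v) (hF i).2.le, ?_⟩
  rw [← Finset.sum_div, div_self (hF i).2.ne']

theorem sigmaAvg_isDist (hl : 0 < l) {F : Fin l → DPState V}
    (hF : ∀ i, (∀ v, 0 ≤ (F i).r v) ∧ 0 < ∑ v, (F i).r v) : IsDist (sigmaAvg F) := by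
  have hl' : (l : ℝ) ≠ 0 := by exact_mod_cast hl.ne'
  have h := sigmaMatrix_isDist hF
  refine ⟨fun v => mul_nonneg (by positivity) (Finset.sum_nonneg fun i _ => (h i).1 v), ?_⟩
  simp only [sigmaAvg]
  rw [← Finset.mul_sum, Finset.sum_comm, Finset.sum_congr rfl fun i _ => (h i).2]
  simp [hl']

theorem sigmaMax_isDist (hl : 0 < l) {F : Fin l → DPState V}
    (hF : ∀ i, (∀ v, 0 ≤ (F i).r v) ∧ 0 < ∑ v, (F i).r v) : IsDist (sigmaMax F) := by
  have h := sigmaMatrix_isDist hF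
  have hle : ∀ v, sigmaMatrix F ⟨0, hl⟩ v ≤ ⨆ i, sigmaMatrix F i v := fun v =>
    le_ciSup (f := fun i => sigmaMatrix F i v) (Set.finite_range _).bddAbove ⟨0, hl⟩
  have hpos : 0 < sigmaNorm F := by
    have : ∑ v, sigmaMatrix F ⟨0, hl⟩ v ≤ sigmaNorm F := Finset.sum_le_sum fun v _ => hle v
    rw [(h ⟨0, hl⟩).2] at this
    linarith
  refine ⟨fun v => mul_nonneg (by positivity) (((h ⟨0, hl⟩).1 v).trans (hle v)), ?_⟩
  simp only [sigmaMax]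
  rw [← Finset.mul_sum]
  exact one_div_mul_cancel hpos.ne'

/-- A probability vector as a probability mass function. -/
noncomputable def IsDist.toPMF {σ : V → ℝ} (h : IsDist σ) : PMF V :=
  PMF.ofFintype (fun v => ENNReal.ofReal (σ v)) (by
    rw [← ENNReal.ofReal_sum_of_nonneg fun v _ => h.1 v, h.2, ENNReal.ofReal_one])

end StartDistributions

/-! ### Random walks and the estimator -/

section RandomWalks

variable (G : Digraph V) [DecidableRel G.Adj] (hout : ∀ v, 0 < outDeg G v)

/-- The endpoint of a random walk with `k` steps started at `v`; every step goes to a uniformly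
random outgoing neighbour. -/
noncomputable def walkEnd : ℕ → V → PMF V
  | 0, v => PMF.pure v
  | k + 1, v =>
      (PMF.uniformOfFinset (outNbrs G v) (Finset.card_pos.1 (hout v))).bind (walkEnd k)

/-- The geometric distribution on `{0, 1, 2, …}` with `ℙ(L = k) = α (1 - α) ^ k`. -/
noncomputable def geom (α : ℝ) (hα0 : 0 < α) (hα1 : α < 1) : PMF ℕ :=
  ⟨fun k => ENNReal.ofReal (α * (1 - α) ^ k), by
    have h : HasSum (fun k : ℕ => α * (1 - α) ^ k) 1 := by
      have := (hasSum_geometric_of_lt_one (r := 1 - α) (by linarith) (by linarith)).mul_left α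
      rwa [sub_sub_cancel, mul_inv_cancel₀ hα0.ne'] at this
    have hn : ∀ k : ℕ, 0 ≤ α * (1 - α) ^ k := fun k =>
      mul_nonneg hα0.le (pow_nonneg (by linarith) k)
    have h' := ENNReal.ofReal_tsum_of_nonneg hn h.summable
    rw [h.tsum_eq, ENNReal.ofReal_one] at h'
    rw [h']
    exact ENNReal.summable.hasSum⟩

/-- The joint law of the pair `(μ, ν)` formed by the start `μ ∼ σ` and the endpoint `ν` of a random
walk from `μ` whose number of steps is geometric and independent of everything else. -/
noncomputable def sampleWalk (α : ℝ) (hα0 : 0 < α) (hα1 : α < 1) (σ : PMF V) : PMF (V × V) :=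
  σ.bind fun μ => (geom α hα0 hα1).bind fun L => (walkEnd G hout L μ).map fun ν => (μ, ν)

end RandomWalks

/-- The law of `w` independent samples from `D`. -/
noncomputable def iid {X : Type*} (D : PMF X) : (w : ℕ) → PMF (Fin w → X)
  | 0 => PMF.pure Fin.elim0
  | w + 1 => D.bind fun x => (iid D w).map fun xs => Fin.cons x xs

section Estimator

variable {l : ℕ}

/-- The `V × l` matrix whose `j`-th column is the vector `p` of the `j`-th state. -/
def pMatrix (F : Fin l → DPState V) : Matrix V (Fin l) ℝ := Matrix.of fun v j => (F j).p v

/-- The `V × l` matrix whose `j`-th column is the vector `r` of the `j`-th state. -/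
def rMatrix (F : Fin l → DPState V) : Matrix V (Fin l) ℝ := Matrix.of fun v j => (F j).r v

/-- `X = R_Sᵀ diag(1/σ) e_μ e_νᵀ R_T`. A node with `σ(v) = 0` is never sampled as `μ`; its diagonal
entry `1/σ(v)` is read as `0`. -/
noncomputable def sampleMatrix (F B : Fin l → DPState V) (σ : V → ℝ) (m : V × V) :
    Matrix (Fin l) (Fin l) ℝ :=
  (rMatrix F).transpose * Matrix.diagonal (fun v => 1 / σ v)
    * Matrix.vecMulVec (Pi.single m.1 (1 : ℝ)) (Pi.single m.2 (1 : ℝ)) * rMatrix B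

/-- The estimate `P_T(S,:) + P_Sᵀ R_T + (1/w) ∑ X_i` computed from the sampled pairs `(μ_i, ν_i)`. -/
noncomputable def estimate (s : Fin l → V) (F B : Fin l → DPState V) (σ : V → ℝ) {w : ℕ}
    (m : Fin w → V × V) : Matrix (Fin l) (Fin l) ℝ :=
  (pMatrix B).submatrix s id + (pMatrix F).transpose * rMatrix B
    + (1 / (w : ℝ)) • ∑ i, sampleMatrix F B σ (m i)

/-- The law of the random matrix returned by `FW-BW-MCMC-Many-Pair` with `w` walks started from the
distribution `σ`, when the dynamic programs for the sources and for the targets have returned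
`F` and `B`. -/
noncomputable def estimateLaw (G : Digraph V) [DecidableRel G.Adj]
    (hout : ∀ v, 0 < outDeg G v) (α : ℝ) (hα0 : 0 < α) (hα1 : α < 1) (s : Fin l → V)
    (F B : Fin l → DPState V) {σ : V → ℝ} (hσ : IsDist σ) (w : ℕ) :
    PMF (Matrix (Fin l) (Fin l) ℝ) :=
  (iid (sampleWalk G hout α hα0 hα1 hσ.toPMF) w).map (estimate s F B σ)

/-- The operator norm `‖A‖₂` with respect to Euclidean norms. -/
noncomputable def opNorm (A : Matrix (Fin l) (Fin l) ℝ) : ℝ :=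
  ‖Matrix.toEuclideanCLM (𝕜 := ℝ) A‖

/-- The Frobenius norm. -/
noncomputable def frobNorm (A : Matrix (Fin l) (Fin l) ℝ) : ℝ :=
  √(∑ i, ∑ j, A i j ^ 2)

/-- The stable rank `(‖A‖_F / ‖A‖₂)²` (equal to `0` for `A = 0`). -/
noncomputable def srank (A : Matrix (Fin l) (Fin l) ℝ) : ℝ :=
  (frobNorm A / opNorm A) ^ 2

/-- The event `‖A - Â‖₂ ≤ ε max {‖A‖₂, 1}`. -/
def accurate (A : Matrix (Fin l) (Fin l) ℝ) (ε : ℝ) : Set (Matrix (Fin l) (Fin l) ℝ) :=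
  {A' | opNorm (A - A') ≤ ε * max (opNorm A) 1}

end Estimator

end PPR

/-! Each update preserves an exact identity: `p + rΠ` remains row `s` of `Π` in the forward program,
and `p + Πr` remains column `t` in the backward one. Together they give `Π(S,T) = P_T(S,:) + P_Sᵀ
R_T + R_Sᵀ Π R_T` (`pprMatrix_submatrix_eq`). A sampled pair has law `σ(μ) Π(μ,ν)`, so the weighted
sample `X` has mean `M = R_Sᵀ Π R_T` (`mean_sampleMatrix`), and the error is the deviation of an
empirical mean of i.i.d. rank-one matrices.

This deviation is controlled by a matrix Bernstein inequality (`mean_iid_opNorm_sum_le`), obtained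
from the Golden–Thompson inequality by peeling off one sample at a time. It needs a bound `‖X‖ ≤ L`,
which comes from the two thresholds and the choice of `σ`, and a second-moment bound. As all `p` and
`r` are nonnegative, `M ≤ Π(S,T)` entrywise, and `mean_vecMulVec_sq_le` bounds the second moment by
`L √l ‖Π(S,T)‖₂`. Being linear in the norm, it permits a relative error with a sample size
independent of that norm. The products `L √l` are `l² rs rt` for `σ_avg` and `l^(3/2) ‖Σ‖_{∞,1} rs
rt` for `σ_max`. The stable rank enters only through `srank ≥ 1` for a nonzero matrix; if `Π(S,T) =
0`, the estimate is exact.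

Termination: every iteration lowers a nonnegative potential by a fixed amount. The potential is the
residual mass in the forward program and the missing mass `∑ (Π(·,t) - p)` in the backward one. -/

/-! ### The Lie–Trotter product formula -/

open Filter Topology NormedSpace in
/-- The norm of an exponential in a Banach algebra. -/
theorem norm_exp_le_exp_norm_of_normOneClass {A : Type*} [NormedRing A] [NormedAlgebra ℝ A]
    [CompleteSpace A] [NormOneClass A] (x : A) : ‖exp x‖ ≤ Real.exp ‖x‖ := by
  rw [Real.exp_eq_exp_ℝ, congrFun (exp_eq_tsum ℝ (𝔸 := A)) x,
    congrFun (exp_eq_tsum ℝ (𝔸 := ℝ)) ‖x‖]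
  have hs := expSeries_summable' (𝕂 := ℝ) ‖x‖
  refine tsum_of_norm_bounded hs.hasSum fun n => ?_
  rw [norm_smul, smul_eq_mul, Real.norm_of_nonneg (by positivity)]
  exact mul_le_mul_of_nonneg_left (norm_pow_le x n) (by positivity)

/-- Telescoping: each of the `n` exchanges of a factor `x` for `y` costs at most `M ^ n * ‖x - y‖`.
The crude `M ^ n` instead of `M ^ (n - 1)` is harmless since `1 ≤ M`. -/
theorem norm_pow_sub_pow_le {A : Type*} [NormedRing A] [NormOneClass A] {x y : A} {M : ℝ}
    (hM : 1 ≤ M) (hx : ‖x‖ ≤ M) (hy : ‖y‖ ≤ M) (n : ℕ) :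
    ‖x ^ n - y ^ n‖ ≤ n * M ^ n * ‖x - y‖ := by
  induction n with
  | zero => simp
  | succ n ih =>
    have e : x ^ (n + 1) - y ^ (n + 1) = x ^ n * (x - y) + (x ^ n - y ^ n) * y := by
      rw [pow_succ, pow_succ]; noncomm_ring
    have h1 : ‖x ^ n * (x - y)‖ ≤ M ^ (n + 1) * ‖x - y‖ := by
      refine (norm_mul_le _ _).trans (mul_le_mul_of_nonneg_right ?_ (norm_nonneg _))
      exact ((norm_pow_le x n).trans (pow_le_pow_left₀ (norm_nonneg _) hx n)).trans
        (pow_le_pow_right₀ hM n.le_succ)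
    have h2 : ‖(x ^ n - y ^ n) * y‖ ≤ n * M ^ n * ‖x - y‖ * M :=
      (norm_mul_le _ _).trans (mul_le_mul ih hy (norm_nonneg _) (by positivity))
    rw [e]
    refine (norm_add_le _ _).trans ((add_le_add h1 h2).trans (le_of_eq ?_))
    push_cast; ring

open Filter Topology NormedSpace in
/-- The Lie–Trotter product formula. -/
theorem tendsto_exp_mul_exp_pow {A : Type*} [NormedRing A] [NormedAlgebra ℝ A]
    [CompleteSpace A] [NormOneClass A] (x y : A) :
    Tendsto (fun n : ℕ => (exp ((1 / (n : ℝ)) • x) * exp ((1 / (n : ℝ)) • y)) ^ n) atTop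
      (𝓝 (exp (x + y))) := by
  -- Both curves have derivative `x + y` at `0`, so one step of length `1/n` has error `o(1/n)`.
  have hder : HasDerivAt (fun t : ℝ => exp (t • x) * exp (t • y) - exp (t • (x + y))) 0 0 := by
    have hx := hasDerivAt_exp_smul_const (𝕂 := ℝ) x 0
    have hy := hasDerivAt_exp_smul_const (𝕂 := ℝ) y 0
    have hxy := hasDerivAt_exp_smul_const (𝕂 := ℝ) (x + y) 0
    refine ((hx.mul hy).sub hxy).congr_deriv ?_
    simp
  have hlim : Tendsto (fun n : ℕ => (n : ℝ) * ‖exp ((1 / (n : ℝ)) • x) * exp ((1 / (n : ℝ)) • y)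
      - exp ((1 / (n : ℝ)) • (x + y))‖) atTop (𝓝 0) := by
    have h := hder.tendsto_slope_zero_right
    have hn : Tendsto (fun n : ℕ => 1 / (n : ℝ)) atTop (𝓝[>] 0) := by
      refine tendsto_nhdsWithin_iff.2 ⟨tendsto_one_div_atTop_nhds_zero_nat, ?_⟩
      filter_upwards [eventually_gt_atTop 0] with n hn
      have : (0 : ℝ) < n := by exact_mod_cast hn
      exact one_div_pos.2 this
    have h' := (h.comp hn).norm
    rw [norm_zero] at h'
    refine h'.congr fun n => ?_
    simp [norm_smul]
  rw [tendsto_iff_norm_sub_tendsto_zero]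
  have hb := hlim.const_mul (Real.exp (‖x‖ + ‖y‖))
  rw [mul_zero] at hb
  refine squeeze_zero' (Eventually.of_forall fun n => norm_nonneg _) ?_ hb
  filter_upwards [eventually_gt_atTop 0] with n hn
  have hn0 : (n : ℝ) ≠ 0 := by exact_mod_cast hn.ne'
  have hn1 : (n : ℝ) * (1 / (n : ℝ)) = 1 := by field_simp
  have hnn : (0 : ℝ) ≤ 1 / (n : ℝ) := by positivity
  have he : exp (x + y) = exp ((1 / (n : ℝ)) • (x + y)) ^ n := by
    let _ := NormedAlgebra.restrictScalars ℚ ℝ A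
    rw [← exp_nsmul, ← Nat.cast_smul_eq_nsmul ℝ, smul_smul, hn1, one_smul]
  have hsum : 0 ≤ 1 / (n : ℝ) * (‖x‖ + ‖y‖) := by positivity
  have hz : ∀ z : A, ‖exp ((1 / (n : ℝ)) • z)‖ ≤ Real.exp (1 / (n : ℝ) * ‖z‖) := fun z => by
    refine (norm_exp_le_exp_norm_of_normOneClass _).trans (le_of_eq ?_)
    rw [norm_smul, Real.norm_of_nonneg hnn]
  have h1 : ‖exp ((1 / (n : ℝ)) • x) * exp ((1 / (n : ℝ)) • y)‖
      ≤ Real.exp (1 / (n : ℝ) * (‖x‖ + ‖y‖)) := by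
    rw [mul_add, Real.exp_add]
    exact (norm_mul_le _ _).trans (mul_le_mul (hz x) (hz y) (norm_nonneg _) (Real.exp_pos _).le)
  have h2 : ‖exp ((1 / (n : ℝ)) • (x + y))‖ ≤ Real.exp (1 / (n : ℝ) * (‖x‖ + ‖y‖)) :=
    (hz _).trans (Real.exp_le_exp.2 (mul_le_mul_of_nonneg_left (norm_add_le _ _) hnn))
  rw [he]
  -- With `M = exp ((‖x‖ + ‖y‖) / n)` the factor `M ^ n` does not depend on `n`, and `n` times the
  -- one-step error tends to `0`.
  refine (norm_pow_sub_pow_le (Real.one_le_exp hsum) h1 h2 n).trans (le_of_eq ?_)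
  rw [← Real.exp_nat_mul, ← mul_assoc (n : ℝ), hn1, one_mul]
  ring

/-! ### The Golden–Thompson inequality -/

namespace Matrix

theorem trace_mul_pow_comm {n : Type*} [Fintype n] [DecidableEq n] (A B : Matrix n n ℝ) (k : ℕ) :
    ((A * B) ^ k).trace = ((B * A) ^ k).trace := by
  cases k with
  | zero => simp
  | succ k =>
    have h : (A * B) ^ k * A = A * (B * A) ^ k := (mul_pow_mul A B k)
    rw [pow_succ, ← mul_assoc, h, mul_assoc, trace_mul_comm, mul_assoc, ← pow_succ]

/-- Entrywise `2ab ≤ a² + b²` for the Frobenius inner product of `A` and `Bᵀ`. -/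
theorem trace_mul_le {n : Type*} [Fintype n] (A B : Matrix n n ℝ) :
    (A * B).trace ≤ ((A * Aᵀ).trace + (B * Bᵀ).trace) / 2 := by
  have hB : (B * Bᵀ).trace = ∑ i, ∑ j, B j i * B j i := by
    rw [Finset.sum_comm]
    simp only [trace, diag_apply, mul_apply, transpose_apply]
  rw [hB]
  simp only [trace, diag_apply, mul_apply, transpose_apply]
  rw [← Finset.sum_add_distrib, Finset.sum_div]
  refine Finset.sum_le_sum fun i _ => ?_
  rw [← Finset.sum_add_distrib, Finset.sum_div]
  exact Finset.sum_le_sum fun j _ => by nlinarith [sq_nonneg (A i j - B j i)]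

variable {n : Type*} [Fintype n] [DecidableEq n]

/-- Joint induction for the trace inequalities behind the Golden–Thompson inequality. -/
theorem trace_pow_two_pow_le_aux (k : ℕ) :
    (∀ M : Matrix n n ℝ, (M ^ 2 ^ (k + 1)).trace ≤ ((M * Mᵀ) ^ 2 ^ k).trace) ∧
      ∀ X Y : Matrix n n ℝ, Xᵀ = X → Yᵀ = Y →
        ((X * Y) ^ 2 ^ k).trace ≤ (X ^ 2 ^ k * Y ^ 2 ^ k).trace := by
  induction k with
  | zero =>
    refine ⟨fun M => ?_, fun X Y _ _ => by simp⟩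
    have h := trace_mul_le M M
    simp only [zero_add, pow_one, pow_zero, sq]
    linarith
  | succ k ih =>
    obtain ⟨hQ, hC⟩ := ih
    constructor
    -- Apply the first claim at `k` to `M²`, rotate the product cyclically to `(MᵀM)(MMᵀ)`, and
    -- separate the factors by the second claim. After `trace_mul_le` both halves equal the trace of
    -- `(MMᵀ) ^ 2 ^ (k + 1)`.
    · intro M
      have h1 : (M ^ 2 ^ (k + 1 + 1)).trace ≤ ((M * M * (M * M)ᵀ) ^ 2 ^ k).trace := by
        rw [pow_succ' 2 (k + 1), pow_mul, sq M]
        exact hQ (M * M)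
      have h2 : ((M * M * (M * M)ᵀ) ^ 2 ^ k).trace = (((Mᵀ * M) * (M * Mᵀ)) ^ 2 ^ k).trace := by
        rw [transpose_mul, mul_assoc M M, trace_mul_pow_comm, trace_mul_pow_comm (Mᵀ * M)]
        simp only [mul_assoc]
      have h3 := hC (Mᵀ * M) (M * Mᵀ) (by simp) (by simp)
      have h4 := trace_mul_le ((Mᵀ * M) ^ 2 ^ k) ((M * Mᵀ) ^ 2 ^ k)
      simp only [transpose_pow, transpose_mul, transpose_transpose] at h4
      rw [← pow_add, ← pow_add, ← two_mul, ← pow_succ', trace_mul_pow_comm Mᵀ M] at h4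
      linarith
    -- For `M = XY` one has `MMᵀ = XYYX`, cyclically `X²Y²`; the second claim at `k` then applies to
    -- `X²` and `Y²`.
    · intro X Y hX hY
      have h1 : ((X * Y) ^ 2 ^ (k + 1)).trace ≤ ((X * X * (Y * Y)) ^ 2 ^ k).trace := by
        refine (hQ (X * Y)).trans (le_of_eq ?_)
        rw [transpose_mul, hX, hY, ← mul_assoc, trace_mul_pow_comm]
        simp only [mul_assoc]
      refine h1.trans ((hC _ _ (by simp [hX]) (by simp [hY])).trans (le_of_eq ?_))
      rw [← sq, ← sq, ← pow_mul, ← pow_mul, ← pow_succ']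

open Filter Topology NormedSpace in
open scoped Matrix.Norms.Operator in
/-- The **Golden–Thompson inequality** for real symmetric matrices. -/
theorem trace_exp_add_le {A B : Matrix n n ℝ} (hA : Aᵀ = A) (hB : Bᵀ = B) :
    (exp (A + B)).trace ≤ (exp A * exp B).trace := by
  cases isEmpty_or_nonempty n with
  | inl h => simp [trace]
  | inr h =>
    -- Along `n = 2 ^ k`, the trace inequality for `exp (A/n)` and `exp (B/n)` has the constant
    -- right-hand side `tr (exp A exp B)`, so it passes to the Lie–Trotter limit.
    have h := (tendsto_exp_mul_exp_pow A B).comp (tendsto_pow_atTop_atTop_of_one_lt one_lt_two)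
    have ht := ((continuous_id (X := Matrix n n ℝ)).matrix_trace.tendsto _).comp h
    refine le_of_tendsto ht (Eventually.of_forall fun k => ?_)
    have hsc : ∀ C : Matrix n n ℝ, exp ((1 / ((2 ^ k : ℕ) : ℝ)) • C) ^ 2 ^ k = exp C := fun C => by
      rw [← exp_nsmul, ← Nat.cast_smul_eq_nsmul ℝ, smul_smul]
      simp
    have hs : ∀ (c : ℝ) (C : Matrix n n ℝ), Cᵀ = C → (exp (c • C))ᵀ = exp (c • C) :=
      fun c C hC => by rw [← exp_transpose, transpose_smul, hC]
    have := (trace_pow_two_pow_le_aux k).2 _ _ (hs (1 / ((2 ^ k : ℕ) : ℝ)) A hA)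
      (hs (1 / ((2 ^ k : ℕ) : ℝ)) B hB)
    rw [hsc, hsc] at this
    exact this

end Matrix

/-! ### Spectral estimates and the matrix Laplace transform -/

/-- Bernstein's bound for the exponential function. -/
theorem Real.exp_le_one_add_add_sq_div {x c : ℝ} (hx : |x| ≤ c) (hc : c < 3) :
    Real.exp x ≤ 1 + x + x ^ 2 * (1 / (2 * (1 - c / 3))) := by
  have hc0 : 0 ≤ c := (abs_nonneg x).trans hx
  have hr0 : 0 ≤ c / 3 := by positivity
  have hr1 : c / 3 < 1 := by linarith
  have hs : HasSum (fun k : ℕ => x ^ k / (k.factorial : ℝ)) (Real.exp x) := by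
    rw [Real.exp_eq_exp_ℝ]
    exact NormedSpace.expSeries_div_hasSum_exp x
  have hs2 := (hasSum_nat_add_iff' 2).2 hs
  have hg : HasSum (fun k : ℕ => x ^ 2 / 2 * (c / 3) ^ k) (x ^ 2 / 2 * (1 - c / 3)⁻¹) :=
    (hasSum_geometric_of_lt_one hr0 hr1).mul_left _
  -- This makes the exponential tail from degree two on dominated by `x²/2` times a geometric series
  -- of ratio `c/3`.
  have hfac : ∀ k : ℕ, (2 : ℝ) * 3 ^ k ≤ ((k + 2).factorial : ℝ) := by
    intro k
    induction k with
    | zero => norm_num [Nat.factorial]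
    | succ k ih =>
      rw [show k + 1 + 2 = (k + 2) + 1 by ring, Nat.factorial_succ, pow_succ]
      push_cast
      have : (0 : ℝ) ≤ k := k.cast_nonneg
      nlinarith [pow_pos (by norm_num : (0 : ℝ) < 3) k]
  have hle := hasSum_le (fun k => ?_) hs2 hg
  · simp only [Finset.sum_range_succ, Finset.sum_range_zero] at hle
    norm_num at hle
    have e : x ^ 2 * (1 / (2 * (1 - c / 3))) = x ^ 2 / 2 * (1 - c / 3)⁻¹ := by
      have : (1 - c / 3) ≠ 0 := by linarith
      field_simp
    rw [e]
    linarith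
  · have h1 : x ^ k ≤ c ^ k := by
      calc x ^ k ≤ |x ^ k| := le_abs_self _
        _ = |x| ^ k := abs_pow _ _
        _ ≤ c ^ k := pow_le_pow_left₀ (abs_nonneg _) hx k
    have h2 : (0 : ℝ) < (k + 2).factorial := by positivity
    rw [div_le_iff₀ h2, pow_add, div_pow]
    have h3 : x ^ k * x ^ 2 ≤ c ^ k * x ^ 2 := mul_le_mul_of_nonneg_right h1 (sq_nonneg _)
    have h4 : x ^ 2 / 2 * (c ^ k / 3 ^ k) * (2 * 3 ^ k) = c ^ k * x ^ 2 := by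
      field_simp
    have h5 : 0 ≤ x ^ 2 / 2 * (c ^ k / 3 ^ k) := by positivity
    nlinarith [mul_le_mul_of_nonneg_left (hfac k) h5]

namespace Matrix

open NormedSpace

variable {n : Type*} [Fintype n] [DecidableEq n]

/-- Orthogonal diagonalization of a real symmetric matrix. -/
theorem exists_orthogonal_diagonalization {H : Matrix n n ℝ} (hH : Hᵀ = H) :
    ∃ (U : Matrix n n ℝ) (d : n → ℝ), U * Uᵀ = 1 ∧ H = U * diagonal d * Uᵀ := by
  have hh : H.IsHermitian := by rw [IsHermitian, conjTranspose_eq_transpose_of_trivial, hH]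
  refine ⟨hh.eigenvectorUnitary, hh.eigenvalues, ?_, ?_⟩
  · have := Unitary.mul_star_self_of_mem hh.eigenvectorUnitary.2
    rwa [star_eq_conjTranspose, conjTranspose_eq_transpose_of_trivial] at this
  · have := hh.spectral_theorem
    rw [Unitary.conjStarAlgAut_apply, star_eq_conjTranspose,
      conjTranspose_eq_transpose_of_trivial] at this
    exact this

theorem exp_orthogonal_conj {U : Matrix n n ℝ} (hU : U * Uᵀ = 1) (d : n → ℝ) :
    exp (U * diagonal d * Uᵀ) = U * diagonal (fun i => Real.exp (d i)) * Uᵀ := by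
  have hinv : U⁻¹ = Uᵀ := inv_eq_right_inv hU
  have hu : IsUnit U := IsUnit.of_mul_eq_one _ hU
  rw [← hinv, exp_conj U _ hu, exp_diagonal]
  congr 3
  ext i
  rw [Pi.coe_exp, Real.exp_eq_exp_ℝ]

theorem dotProduct_conj_diagonal_mulVec (U : Matrix n n ℝ) (d u : n → ℝ) :
    u ⬝ᵥ (U * diagonal d * Uᵀ) *ᵥ u = ∑ i, d i * (Uᵀ *ᵥ u) i ^ 2 := by
  rw [← mulVec_mulVec, ← mulVec_mulVec, dotProduct_mulVec, ← mulVec_transpose, dotProduct]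
  refine Finset.sum_congr rfl fun i _ => ?_
  rw [mulVec_diagonal]
  ring

theorem dotProduct_self_orthogonal {U : Matrix n n ℝ} (hU : U * Uᵀ = 1) (u : n → ℝ) :
    u ⬝ᵥ u = ∑ i, (Uᵀ *ᵥ u) i ^ 2 := by
  have h := dotProduct_conj_diagonal_mulVec U 1 u
  rw [show diagonal (1 : n → ℝ) = 1 from diagonal_one, mul_one, hU, one_mulVec] at h
  simpa using h

/-- If the eigenvalues of `H` lie in `[-c, c]`, then
`exp H ≤ 1 + H + H² / (2 (1 - c / 3))` in the Loewner order. -/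
theorem dotProduct_exp_mulVec_le {H : Matrix n n ℝ} (hH : Hᵀ = H) {c : ℝ} (hc : c < 3)
    (hb : ∀ u, |u ⬝ᵥ H *ᵥ u| ≤ c * (u ⬝ᵥ u)) (u : n → ℝ) :
    u ⬝ᵥ exp H *ᵥ u ≤ u ⬝ᵥ u + u ⬝ᵥ H *ᵥ u
      + (H *ᵥ u) ⬝ᵥ (H *ᵥ u) * (1 / (2 * (1 - c / 3))) := by
  obtain ⟨U, d, hU, rfl⟩ := exists_orthogonal_diagonalization hH
  have hU' : Uᵀ * U = 1 := mul_eq_one_comm.1 hU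
  -- Test the form on the `i`-th eigenvector `U eᵢ`. The claim then reduces to the scalar inequality
  -- in each eigendirection.
  have hd : ∀ i, |d i| ≤ c := by
    intro i
    have h := hb (U *ᵥ Pi.single i 1)
    rw [dotProduct_conj_diagonal_mulVec, dotProduct_self_orthogonal hU, mulVec_mulVec, hU',
      one_mulVec] at h
    simpa [Pi.single_apply] using h
  have hsq : ((U * diagonal d * Uᵀ) *ᵥ u) ⬝ᵥ ((U * diagonal d * Uᵀ) *ᵥ u)
      = ∑ i, d i ^ 2 * (Uᵀ *ᵥ u) i ^ 2 := by
    rw [dotProduct_self_orthogonal hU]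
    refine Finset.sum_congr rfl fun i _ => ?_
    rw [mulVec_mulVec, ← mul_assoc, ← mul_assoc, hU', one_mul, ← mulVec_mulVec, mulVec_diagonal]
    ring
  rw [exp_orthogonal_conj hU, hsq, dotProduct_conj_diagonal_mulVec,
    dotProduct_conj_diagonal_mulVec, dotProduct_self_orthogonal hU, Finset.sum_mul,
    ← Finset.sum_add_distrib, ← Finset.sum_add_distrib]
  refine Finset.sum_le_sum fun i _ => ?_
  have := mul_le_mul_of_nonneg_right (Real.exp_le_one_add_add_sq_div (hd i) hc)
    (sq_nonneg ((Uᵀ *ᵥ u) i))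
  linarith

theorem trace_exp_nonneg {H : Matrix n n ℝ} (hH : Hᵀ = H) : 0 ≤ (exp H).trace := by
  obtain ⟨U, d, hU, rfl⟩ := exists_orthogonal_diagonalization hH
  rw [exp_orthogonal_conj hU, trace_mul_comm, ← mul_assoc, mul_eq_one_comm.1 hU, one_mul,
    trace_diagonal]
  positivity

/-- If the quadratic form of `H` exceeds `t` somewhere, then `tr exp H ≥ exp t`. -/
theorem exp_le_trace_exp {H : Matrix n n ℝ} (hH : Hᵀ = H) {t : ℝ} {u : n → ℝ}
    (hu : t * (u ⬝ᵥ u) < u ⬝ᵥ H *ᵥ u) : Real.exp t ≤ (exp H).trace := by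
  obtain ⟨U, d, hU, rfl⟩ := exists_orthogonal_diagonalization hH
  rw [exp_orthogonal_conj hU, trace_mul_comm, ← mul_assoc, mul_eq_one_comm.1 hU, one_mul,
    trace_diagonal]
  rw [dotProduct_conj_diagonal_mulVec, dotProduct_self_orthogonal hU, Finset.mul_sum] at hu
  obtain ⟨i, -, hi⟩ := Finset.exists_lt_of_sum_lt hu
  have hti : t < d i := lt_of_mul_lt_mul_right hi (sq_nonneg _)
  exact (Real.exp_le_exp.2 hti.le).trans
    (Finset.single_le_sum (f := fun j => Real.exp (d j)) (fun j _ => (Real.exp_pos _).le)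
      (Finset.mem_univ i))

/-- `tr (exp A B) ≤ c tr (exp A)` if `B ≤ c` in the Loewner order. -/
theorem trace_exp_mul_le {A B : Matrix n n ℝ} (hA : Aᵀ = A) {c : ℝ}
    (hB : ∀ u, u ⬝ᵥ B *ᵥ u ≤ c * (u ⬝ᵥ u)) : (exp A * B).trace ≤ c * (exp A).trace := by
  obtain ⟨U, d, hU, rfl⟩ := exists_orthogonal_diagonalization hA
  rw [exp_orthogonal_conj hU]
  -- In the eigenbasis of `A` the trace is a positive combination of values of the form of `B`, so
  -- the bound on `B` can be applied termwise.
  have h1 : (U * diagonal (fun i => Real.exp (d i)) * Uᵀ * B).trace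
      = ∑ i, Real.exp (d i) * ((U.col i) ⬝ᵥ B *ᵥ (U.col i)) := by
    rw [trace_mul_comm, ← mul_assoc, trace_mul_comm, ← mul_assoc, ← mul_assoc]
    simp only [trace, diag_apply]
    refine Finset.sum_congr rfl fun i _ => ?_
    rw [mul_diagonal, mul_comm]
    congr 1
    rw [mul_assoc, mul_apply]
    rfl
  have h2 : (U * diagonal (fun i => Real.exp (d i)) * Uᵀ).trace
      = ∑ i, Real.exp (d i) * ((U.col i) ⬝ᵥ (U.col i)) := by
    rw [trace_mul_comm, ← mul_assoc]
    simp only [trace, diag_apply]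
    refine Finset.sum_congr rfl fun i _ => ?_
    rw [mul_diagonal, mul_comm]
    rfl
  rw [h1, h2, Finset.mul_sum]
  refine Finset.sum_le_sum fun i _ => ?_
  have := mul_le_mul_of_nonneg_left (hB (U.col i)) (Real.exp_pos (d i)).le
  linarith

/-- The matrix Laplace transform of one centred random symmetric matrix, with Bernstein's
bound. -/
theorem sum_trace_exp_add_le {X : Type*} [Fintype X] {q : X → ℝ} (hq : ∀ x, 0 ≤ q x)
    (hq1 : ∑ x, q x = 1) {Y : X → Matrix n n ℝ} (hY : ∀ x, (Y x)ᵀ = Y x)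
    (hmean : ∑ x, q x • Y x = 0) {L v θ : ℝ} (hθ : 0 ≤ θ) (hL : θ * L < 3)
    (hb : ∀ x u, |u ⬝ᵥ Y x *ᵥ u| ≤ L * (u ⬝ᵥ u))
    (hv : ∀ u, ∑ x, q x * ((Y x *ᵥ u) ⬝ᵥ (Y x *ᵥ u)) ≤ v * (u ⬝ᵥ u))
    {A : Matrix n n ℝ} (hA : Aᵀ = A) :
    ∑ x, q x * (exp (A + θ • Y x)).trace
      ≤ Real.exp (v * θ ^ 2 * (1 / (2 * (1 - θ * L / 3)))) * (exp A).trace := by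
  set g : ℝ := 1 / (2 * (1 - θ * L / 3)) with hg
  have hg0 : 0 ≤ g := by
    have : 0 < 1 - θ * L / 3 := by linarith
    positivity
  have hYs : ∀ x, (θ • Y x)ᵀ = θ • Y x := fun x => by rw [transpose_smul, hY]
  -- Golden–Thompson detaches the fixed `A` from the random matrix, leaving only the mean of `exp (θ
  -- Y)` to bound; there the linear term vanishes by centring.
  have hsum : ∑ x, q x * (exp (A + θ • Y x)).trace
      ≤ (exp A * ∑ x, q x • exp (θ • Y x)).trace := by
    rw [Matrix.mul_sum, trace_sum]
    refine Finset.sum_le_sum fun x _ => ?_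
    rw [Matrix.mul_smul, trace_smul, smul_eq_mul]
    exact mul_le_mul_of_nonneg_left (trace_exp_add_le hA (hYs x)) (hq x)
  refine hsum.trans (trace_exp_mul_le hA fun u => ?_)
  have huu : 0 ≤ u ⬝ᵥ u :=
     Finset.sum_nonneg fun i _ => mul_self_nonneg (u i)
  have hx : ∀ x, u ⬝ᵥ exp (θ • Y x) *ᵥ u ≤ u ⬝ᵥ u + θ * (u ⬝ᵥ Y x *ᵥ u)
      + θ ^ 2 * ((Y x *ᵥ u) ⬝ᵥ (Y x *ᵥ u)) * g := fun x => by
    have := dotProduct_exp_mulVec_le (hYs x) hL (fun u => ?_) u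
    · simp only [smul_mulVec, dotProduct_smul, smul_dotProduct, smul_eq_mul] at this
      rw [sq]
      linarith
    · rw [smul_mulVec, dotProduct_smul, smul_eq_mul, abs_mul, abs_of_nonneg hθ, mul_assoc]
      exact mul_le_mul_of_nonneg_left (hb x u) hθ
  have hm : ∑ x, q x * (u ⬝ᵥ Y x *ᵥ u) = 0 := by
    have := congrArg (fun M => u ⬝ᵥ M *ᵥ u) hmean
    simpa [sum_mulVec, dotProduct_sum, smul_mulVec, dotProduct_smul] using this
  calc u ⬝ᵥ (∑ x, q x • exp (θ • Y x)) *ᵥ u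
      = ∑ x, q x * (u ⬝ᵥ exp (θ • Y x) *ᵥ u) := by
        simp [sum_mulVec, dotProduct_sum, smul_mulVec, dotProduct_smul]
    _ ≤ ∑ x, q x * (u ⬝ᵥ u + θ * (u ⬝ᵥ Y x *ᵥ u)
          + θ ^ 2 * ((Y x *ᵥ u) ⬝ᵥ (Y x *ᵥ u)) * g) :=
        Finset.sum_le_sum fun x _ => mul_le_mul_of_nonneg_left (hx x) (hq x)
    _ = (∑ x, q x) * (u ⬝ᵥ u) + θ * (∑ x, q x * (u ⬝ᵥ Y x *ᵥ u))
          + θ ^ 2 * g * ∑ x, q x * ((Y x *ᵥ u) ⬝ᵥ (Y x *ᵥ u)) := by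
        rw [Finset.sum_mul, Finset.mul_sum, Finset.mul_sum, ← Finset.sum_add_distrib,
          ← Finset.sum_add_distrib]
        exact Finset.sum_congr rfl fun x _ => by ring
    _ ≤ u ⬝ᵥ u + θ ^ 2 * g * (v * (u ⬝ᵥ u)) := by
        rw [hq1, hm]
        have := mul_le_mul_of_nonneg_left (hv u) (by positivity : 0 ≤ θ ^ 2 * g)
        linarith
    _ = (v * θ ^ 2 * g + 1) * (u ⬝ᵥ u) := by ring
    -- The scalar factor is put in exponential form so that its `w`-th power is explicit.
    _ ≤ Real.exp (v * θ ^ 2 * g) * (u ⬝ᵥ u) :=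
        mul_le_mul_of_nonneg_right (Real.add_one_le_exp _) huu

end Matrix

/-! ### Expectations under finitely supported laws -/

namespace PPR

section Mean

variable {X Y : Type*} [Fintype X] [Fintype Y]

/-- The mean of a real function with respect to a distribution on a finite type. -/
noncomputable def mean (D : PMF X) (f : X → ℝ) : ℝ := ∑ x, (D x).toReal * f x

theorem sum_toReal_eq_one (D : PMF X) : ∑ x, (D x).toReal = 1 := by
  rw [← ENNReal.toReal_sum fun x _ => D.apply_ne_top x,
    ← tsum_fintype (L := .unconditional X), D.tsum_coe,
    ENNReal.toReal_one]

theorem mean_mono (D : PMF X) {f g : X → ℝ} (h : ∀ x, f x ≤ g x) : mean D f ≤ mean D g :=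
  Finset.sum_le_sum fun x _ => mul_le_mul_of_nonneg_left (h x) ENNReal.toReal_nonneg

theorem mean_mul_left (D : PMF X) (c : ℝ) (f : X → ℝ) :
    mean D (fun x => c * f x) = c * mean D f := by
  rw [mean, mean, Finset.mul_sum]
  exact Finset.sum_congr rfl fun x _ => by ring

theorem mean_const (D : PMF X) (c : ℝ) : mean D (fun _ => c) = c := by
  rw [mean, ← Finset.sum_mul, sum_toReal_eq_one, one_mul]

theorem mean_pure [DecidableEq X] (a : X) (f : X → ℝ) : mean (PMF.pure a) f = f a := by
  rw [mean, Finset.sum_eq_single a]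
  · simp
  · intro b _ hb
    simp [PMF.pure_apply, hb]
  · simp

theorem mean_bind (D : PMF X) (K : X → PMF Y) (f : Y → ℝ) :
    mean (D.bind K) f = mean D fun x => mean (K x) f := by
  simp only [mean, PMF.bind_apply, tsum_fintype]
  have : ∀ y, (∑ x, D x * K x y).toReal = ∑ x, (D x).toReal * (K x y).toReal := fun y => by
    rw [ENNReal.toReal_sum fun x _ => ENNReal.mul_ne_top (D.apply_ne_top x) ((K x).apply_ne_top y)]
    exact Finset.sum_congr rfl fun x _ => ENNReal.toReal_mul
  simp only [this, Finset.sum_mul, Finset.mul_sum]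
  rw [Finset.sum_comm]
  exact Finset.sum_congr rfl fun x _ => Finset.sum_congr rfl fun y _ => by ring

theorem mean_map (D : PMF X) (g : X → Y) (f : Y → ℝ) :
    mean (D.map g) f = mean D fun x => f (g x) := by
  classical
  rw [← PMF.bind_pure_comp, mean_bind]
  simp only [Function.comp_apply, mean_pure]

theorem mean_iid_succ [DecidableEq X] (D : PMF X) (w : ℕ) (f : (Fin (w + 1) → X) → ℝ) :
    mean (iid D (w + 1)) f = mean D fun x => mean (iid D w) fun xs => f (Fin.cons x xs) := by
  rw [iid, mean_bind]
  simp only [mean_map]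

/-- The complement of an event of probability at most `p` has probability at least `1 - p`. -/
theorem ofReal_one_sub_le_toOuterMeasure (D : PMF X) (s : Set X) {p : ℝ}
    (h : mean D (sᶜ.indicator 1) ≤ p) : ENNReal.ofReal (1 - p) ≤ D.toOuterMeasure s := by
  have h1 : D.toOuterMeasure s = ENNReal.ofReal (mean D (s.indicator 1)) := by
    rw [PMF.toOuterMeasure_apply_fintype, mean, ENNReal.ofReal_sum_of_nonneg]
    · refine Finset.sum_congr rfl fun x _ => ?_
      by_cases hx : x ∈ s
      · simp [hx, ENNReal.ofReal_toReal (D.apply_ne_top x)]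
      · simp [hx]
    · exact fun x _ => mul_nonneg ENNReal.toReal_nonneg
        (Set.indicator_nonneg (fun _ _ => zero_le_one) x)
  have h2 : mean D (s.indicator 1) + mean D (sᶜ.indicator 1) = 1 := by
    rw [mean, mean, ← Finset.sum_add_distrib, ← sum_toReal_eq_one D]
    refine Finset.sum_congr rfl fun x _ => ?_
    by_cases hx : x ∈ s <;> simp [hx]
  rw [h1]
  exact ENNReal.ofReal_le_ofReal (by linarith)

end Mean

/-! ### The matrix Bernstein inequality -/

open NormedSpace Matrix

section Bernstein

variable {X : Type*} [Fintype X] [DecidableEq X]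

/-- Control of the trace moment generating function of an i.i.d. sum. -/
theorem mean_iid_trace_exp_le {n : Type*} [Fintype n] [DecidableEq n] (D : PMF X)
    {Y : X → Matrix n n ℝ} (hY : ∀ x, (Y x)ᵀ = Y x) {θ c : ℝ} (hc : 0 ≤ c)
    (hstep : ∀ A : Matrix n n ℝ, Aᵀ = A →
      mean D (fun x => (exp (A + θ • Y x)).trace) ≤ c * (exp A).trace)
    (w : ℕ) {A : Matrix n n ℝ} (hA : Aᵀ = A) :
    mean (iid D w) (fun m => (exp (A + θ • ∑ i, Y (m i))).trace) ≤ c ^ w * (exp A).trace := by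
  induction w generalizing A with
  | zero => simp [mean_const]
  | succ w ih =>
    rw [mean_iid_succ]
    have h : ∀ x, mean (iid D w) (fun xs =>
        (exp (A + θ • ∑ i, Y ((Fin.cons x xs : Fin (w + 1) → X) i))).trace)
        ≤ c ^ w * (exp (A + θ • Y x)).trace := fun x => by
      -- Condition on the first sample and absorb it into the deterministic part; this is why `A` is
      -- generalized in the induction.
      refine (le_of_eq ?_).trans (ih (A := A + θ • Y x) (by simp [hA, hY]))
      congr 1
      ext xs
      rw [Fin.sum_univ_succ, smul_add, add_assoc]
      simp
    refine (mean_mono D h).trans ?_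
    rw [mean_mul_left, pow_succ, mul_assoc]
    exact mul_le_mul_of_nonneg_left (hstep A hA) (pow_nonneg hc w)

end Bernstein

section Rectangular

variable {l : ℕ}

theorem norm_toLp_sq (a : Fin l → ℝ) :
    ‖(WithLp.toLp 2 a : EuclideanSpace ℝ (Fin l))‖ ^ 2 = a ⬝ᵥ a := by
  rw [EuclideanSpace.norm_sq_eq]
  simp [dotProduct, sq]

theorem zero_le_dotProduct_self (a : Fin l → ℝ) : 0 ≤ a ⬝ᵥ a := by
  rw [← norm_toLp_sq]; positivity

/-- A lower bound on the operator norm is witnessed by the quadratic form of the Hermitian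
dilation. -/
theorem exists_lt_dilation_form {Z : Matrix (Fin l) (Fin l) ℝ} {t : ℝ} (h : t < opNorm Z)
    (ht : 0 ≤ t) :
    ∃ u : Fin l ⊕ Fin l → ℝ, t * (u ⬝ᵥ u) < u ⬝ᵥ (fromBlocks 0 Z Zᵀ 0) *ᵥ u := by
  have h' : ∃ a : EuclideanSpace ℝ (Fin l), t * ‖a‖ < ‖toEuclideanCLM (𝕜 := ℝ) Z a‖ := by
    by_contra hcon
    push Not at hcon
    exact absurd (ContinuousLinearMap.opNorm_le_bound _ ht hcon) (not_le.2 h)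
  obtain ⟨a, ha⟩ := h'
  obtain ⟨a, rfl⟩ : ∃ a', a = WithLp.toLp 2 a' := ⟨a.ofLp, rfl⟩
  rw [toEuclideanCLM_toLp] at ha
  set x := ‖(WithLp.toLp 2 a : EuclideanSpace ℝ (Fin l))‖ with hx
  set y := ‖(WithLp.toLp 2 (Z *ᵥ a) : EuclideanSpace ℝ (Fin l))‖ with hy
  have hx2 : a ⬝ᵥ a = x ^ 2 := (norm_toLp_sq a).symm
  have hy2 : (Z *ᵥ a) ⬝ᵥ (Z *ᵥ a) = y ^ 2 := (norm_toLp_sq _).symm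
  have hx0 : 0 ≤ x := norm_nonneg _
  have hy0 : 0 < y := lt_of_le_of_lt (by positivity) ha
  have hx1 : 0 < x := by
    rcases hx0.lt_or_eq with h0 | h0
    · exact h0
    · have ha0 : a = 0 := by
        have : WithLp.toLp 2 a = (0 : EuclideanSpace ℝ (Fin l)) := norm_eq_zero.1 h0.symm
        simpa using this
      rw [hy, ha0] at hy0
      simp at hy0
  -- The scaling gives both blocks the norm `x = ‖a‖`. The form equals `2xy` and `u ⬝ᵥ u = 2x²`, so
  -- the claim is `t x < y`.
  refine ⟨Sum.elim ((x / y) • (Z *ᵥ a)) a, ?_⟩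
  have hu : Sum.elim ((x / y) • (Z *ᵥ a)) a ⬝ᵥ Sum.elim ((x / y) • (Z *ᵥ a)) a = 2 * x ^ 2 := by
    rw [sumElim_dotProduct_sumElim, smul_dotProduct, dotProduct_smul, hx2, hy2]
    simp only [smul_eq_mul]
    field_simp
    ring
  rw [hu, fromBlocks_mulVec]
  simp only [Sum.elim_comp_inl, Sum.elim_comp_inr, zero_mulVec, zero_add, add_zero]
  rw [sumElim_dotProduct_sumElim, mulVec_transpose, dotProduct_comm a, ← dotProduct_mulVec]
  rw [smul_dotProduct, hy2]
  simp only [smul_eq_mul]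
  have : x / y * y ^ 2 = x * y := by field_simp
  rw [this]
  nlinarith

theorem dilation_transpose (Z : Matrix (Fin l) (Fin l) ℝ) :
    (fromBlocks 0 Z Zᵀ 0)ᵀ = fromBlocks 0 Z Zᵀ 0 := by
  rw [fromBlocks_transpose]; simp

/-- **Matrix Bernstein inequality** for sums of i.i.d. centred matrices, with a free
parameter `θ`. -/
theorem mean_iid_opNorm_sum_le {X : Type*} [Fintype X] [DecidableEq X] (D : PMF X)
    {Z : X → Matrix (Fin l) (Fin l) ℝ} (hmean : ∀ i j, mean D (fun x => Z x i j) = 0)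
    {L v θ t : ℝ} (hθ : 0 < θ) (hL0 : 0 < L) (hL : θ * L < 3) (ht : 0 ≤ t)
    (hb : ∀ x a, (Z x *ᵥ a) ⬝ᵥ (Z x *ᵥ a) ≤ L ^ 2 * (a ⬝ᵥ a))
    (hv : ∀ a, mean D (fun x => (Z x *ᵥ a) ⬝ᵥ (Z x *ᵥ a)) ≤ v * (a ⬝ᵥ a))
    (hv' : ∀ a, mean D (fun x => ((Z x)ᵀ *ᵥ a) ⬝ᵥ ((Z x)ᵀ *ᵥ a)) ≤ v * (a ⬝ᵥ a)) (w : ℕ) :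
    mean (iid D w) ({m : Fin w → X | opNorm (∑ i, Z (m i)) ≤ t}ᶜ.indicator 1)
      ≤ 2 * l * Real.exp (w * (v * θ ^ 2 * (1 / (2 * (1 - θ * L / 3)))) - θ * t) := by
  set Y : X → Matrix (Fin l ⊕ Fin l) (Fin l ⊕ Fin l) ℝ := fun x => fromBlocks 0 (Z x) (Z x)ᵀ 0
    with hYdef
  have hY : ∀ x, (Y x)ᵀ = Y x := fun x => dilation_transpose (Z x)
  have hm : ∑ x, (D x).toReal • Y x = 0 := by
    ext i j
    rw [Matrix.sum_apply]
    rcases i with i | i <;> rcases j with j | j <;> simp [hYdef]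
    · exact hmean i j
    · exact hmean j i
  have hYu : ∀ x (b a : Fin l → ℝ), Y x *ᵥ Sum.elim b a = Sum.elim (Z x *ᵥ a) ((Z x)ᵀ *ᵥ b) := by
    intro x b a
    simp [hYdef, fromBlocks_mulVec]
  have hsplit : ∀ u : Fin l ⊕ Fin l → ℝ, ∃ b a, u = Sum.elim b a := fun u =>
    ⟨u ∘ Sum.inl, u ∘ Sum.inr, (Sum.elim_comp_inl_inr u).symm⟩
  have hbY : ∀ x u, |u ⬝ᵥ Y x *ᵥ u| ≤ L * (u ⬝ᵥ u) := by
    intro x u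
    obtain ⟨b, a, rfl⟩ := hsplit u
    rw [hYu, sumElim_dotProduct_sumElim, sumElim_dotProduct_sumElim, mulVec_transpose,
      dotProduct_comm a, ← dotProduct_mulVec]
    -- Expanding `‖L b ± Z a‖² ≥ 0` and using `‖Z a‖ ≤ L ‖a‖` gives `2 |b ⬝ᵥ Z a| ≤ L (‖a‖² + ‖b‖²)`
    -- after division by `L`.
    have h1 := zero_le_dotProduct_self (L • b - Z x *ᵥ a)
    have h2 := zero_le_dotProduct_self (L • b + Z x *ᵥ a)
    have h3 := hb x a
    simp only [sub_dotProduct, dotProduct_sub, add_dotProduct, dotProduct_add, smul_dotProduct,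
      dotProduct_smul, smul_eq_mul, dotProduct_comm (Z x *ᵥ a) b] at h1 h2
    rw [abs_le]
    constructor
    · refine le_of_mul_le_mul_left ?_ hL0
      nlinarith
    · refine le_of_mul_le_mul_left ?_ hL0
      nlinarith
  -- The square of the dilation is block diagonal with blocks `ZZᵀ` and `ZᵀZ`, which is why both
  -- second moments are assumed.
  have hvY : ∀ u, ∑ x, (D x).toReal * ((Y x *ᵥ u) ⬝ᵥ (Y x *ᵥ u)) ≤ v * (u ⬝ᵥ u) := by
    intro u
    obtain ⟨b, a, rfl⟩ := hsplit u
    simp only [hYu, sumElim_dotProduct_sumElim, mul_add, Finset.sum_add_distrib]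
    have h1 := hv a
    have h2 := hv' b
    simp only [mean] at h1 h2
    linarith
  have hmgf := mean_iid_trace_exp_le D hY (θ := θ) (Real.exp_pos _).le
    (fun A hA => sum_trace_exp_add_le (q := fun x => (D x).toReal)
      (fun x => ENNReal.toReal_nonneg) (sum_toReal_eq_one D) hY hm hθ.le hL hbY hvY hA) w
    (A := 0) transpose_zero
  -- Chernoff's argument: a large operator norm forces a large eigenvalue of the dilation, hence a
  -- large trace exponential.
  have hind : ∀ m : Fin w → X, ({m : Fin w → X | opNorm (∑ i, Z (m i)) ≤ t}ᶜ.indicator 1) m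
      ≤ Real.exp (-(θ * t)) * (exp (0 + θ • ∑ i, Y (m i))).trace := by
    intro m
    have hsym : (θ • ∑ i, Y (m i))ᵀ = θ • ∑ i, Y (m i) := by
      rw [transpose_smul, transpose_sum]; simp only [hY]
    rw [zero_add]
    by_cases hmem : opNorm (∑ i, Z (m i)) ≤ t
    · rw [Set.indicator_of_notMem (by simpa using hmem)]
      exact mul_nonneg (Real.exp_pos _).le (trace_exp_nonneg hsym)
    · rw [Set.indicator_of_mem (by simpa using hmem), Pi.one_apply]
      have hYs : ∑ i, Y (m i) = fromBlocks 0 (∑ i, Z (m i)) (∑ i, Z (m i))ᵀ 0 := by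
        ext i j
        rw [Matrix.sum_apply]
        rcases i with i | i <;> rcases j with j | j <;> simp [hYdef, Matrix.sum_apply]
      obtain ⟨u, hu⟩ := exists_lt_dilation_form (not_le.1 hmem) ht
      rw [← hYs] at hu
      have hθu := exp_le_trace_exp hsym (t := θ * t) (u := u) (by
        rw [smul_mulVec, dotProduct_smul, smul_eq_mul, mul_assoc]
        exact mul_lt_mul_of_pos_left hu hθ)
      rw [Real.exp_neg, inv_mul_eq_div, le_div_iff₀ (Real.exp_pos _), one_mul]
      exact hθu
  refine (mean_mono _ hind).trans ?_
  rw [mean_mul_left]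
  refine (mul_le_mul_of_nonneg_left hmgf (Real.exp_pos _).le).trans (le_of_eq ?_)
  rw [sub_eq_add_neg (_ * _) (θ * t), Real.exp_add, ← Real.exp_nat_mul]
  -- The prefactor `2l` is the trace of `exp 0` on the dilated space.
  simp only [exp_zero, trace_one, Fintype.card_sum, Fintype.card_fin, Nat.cast_add]
  ring

end Rectangular

end PPR

/-! ### Concentration of the empirical mean -/

namespace PPR

section Concentration

open Matrix

variable {l : ℕ} {X : Type*} [Fintype X]

theorem mean_add (D : PMF X) (f g : X → ℝ) :
    mean D (fun x => f x + g x) = mean D f + mean D g := by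
  simp only [mean, mul_add, Finset.sum_add_distrib]

theorem mean_sum {ι : Type*} (s : Finset ι) (D : PMF X) (f : ι → X → ℝ) :
    mean D (fun x => ∑ i ∈ s, f i x) = ∑ i ∈ s, mean D (f i) := by
  simp only [mean, Finset.mul_sum]
  exact Finset.sum_comm

theorem mean_mulVec (D : PMF X) {Z : X → Matrix (Fin l) (Fin l) ℝ} {M : Matrix (Fin l) (Fin l) ℝ}
    (hM : ∀ i j, mean D (fun x => Z x i j) = M i j) (a : Fin l → ℝ) (i : Fin l) :
    mean D (fun x => (Z x *ᵥ a) i) = (M *ᵥ a) i := by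
  simp only [mulVec, dotProduct, mean_sum]
  refine Finset.sum_congr rfl fun j _ => ?_
  rw [← hM i j, mul_comm, ← mean_mul_left]
  simp only [mul_comm]

/-- The variance is the mean square minus the square of the mean. -/
theorem mean_dotProduct_sub_self (D : PMF X) {z : X → Fin l → ℝ} {m : Fin l → ℝ}
    (hm : ∀ i, mean D (fun x => z x i) = m i) :
    mean D (fun x => (z x - m) ⬝ᵥ (z x - m)) = mean D (fun x => z x ⬝ᵥ z x) - m ⬝ᵥ m := by
  have h : mean D (fun x => z x ⬝ᵥ m) = m ⬝ᵥ m := by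
    simp only [dotProduct, mean_sum]
    refine Finset.sum_congr rfl fun i _ => ?_
    simp only [mul_comm _ (m i)]
    rw [mean_mul_left, hm]
  have e : (fun x => (z x - m) ⬝ᵥ (z x - m))
      = fun x => (z x ⬝ᵥ z x + (-2) * (z x ⬝ᵥ m)) + m ⬝ᵥ m := by
    ext x
    simp only [sub_dotProduct, dotProduct_sub, dotProduct_comm m (z x)]
    ring
  rw [e, mean_add, mean_add, mean_mul_left, h, mean_const]
  ring

theorem dotProduct_sub_self_le (a b : Fin l → ℝ) :
    (a - b) ⬝ᵥ (a - b) ≤ 2 * (a ⬝ᵥ a) + 2 * (b ⬝ᵥ b) := by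
  have := zero_le_dotProduct_self (a + b)
  simp only [sub_dotProduct, dotProduct_sub, add_dotProduct, dotProduct_add,
    dotProduct_comm b a] at this ⊢
  linarith

/-- The empirical mean of `w` i.i.d. matrices concentrates around the mean. -/
theorem mean_iid_empirical_le [DecidableEq X] (D : PMF X) {Z : X → Matrix (Fin l) (Fin l) ℝ}
    {M : Matrix (Fin l) (Fin l) ℝ} (hM : ∀ i j, mean D (fun x => Z x i j) = M i j)
    {K m ε p : ℝ} (hK : 0 < K) (hm : 1 ≤ m) (hε : 0 < ε) (hp : 0 < p) (hl : 0 < l)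
    (hb : ∀ x a, (Z x *ᵥ a) ⬝ᵥ (Z x *ᵥ a) ≤ K ^ 2 * (a ⬝ᵥ a))
    (hv : ∀ a, mean D (fun x => (Z x *ᵥ a) ⬝ᵥ (Z x *ᵥ a)) ≤ K * m * (a ⬝ᵥ a))
    (hv' : ∀ a, mean D (fun x => ((Z x)ᵀ *ᵥ a) ⬝ᵥ ((Z x)ᵀ *ᵥ a)) ≤ K * m * (a ⬝ᵥ a))
    {w : ℕ} (hw : 0 < w)
    (hwK : K * Real.log (2 * l / p) * (6 + 4 * ε) / (3 * ε ^ 2) ≤ w) :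
    mean (iid D w)
      ({x : Fin w → X | opNorm (M - (1 / (w : ℝ)) • ∑ i, Z (x i)) ≤ ε * m}ᶜ.indicator 1) ≤ p := by
  have hw' : (0 : ℝ) < w := by exact_mod_cast hw
  have hl' : (0 : ℝ) < l := by exact_mod_cast hl
  have hMt : ∀ i j, mean D (fun x => (Z x)ᵀ i j) = Mᵀ i j := fun i j => hM j i
  have hsq : ∀ (Z : X → Matrix (Fin l) (Fin l) ℝ) (M : Matrix (Fin l) (Fin l) ℝ),
      (∀ i j, mean D (fun x => Z x i j) = M i j) → ∀ a,
      mean D (fun x => ((Z x - M) *ᵥ a) ⬝ᵥ ((Z x - M) *ᵥ a))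
        = mean D (fun x => (Z x *ᵥ a) ⬝ᵥ (Z x *ᵥ a)) - (M *ᵥ a) ⬝ᵥ (M *ᵥ a) := by
    intro Z M hM a
    simp only [sub_mulVec]
    exact mean_dotProduct_sub_self D (fun i => mean_mulVec D hM a i)
  -- Since the variance is nonnegative, the mean inherits the bound `K`, so the centred samples are
  -- bounded by `2K`.
  have hMb : ∀ a, (M *ᵥ a) ⬝ᵥ (M *ᵥ a) ≤ K ^ 2 * (a ⬝ᵥ a) := fun a => by
    have h1 := hsq Z M hM a
    have h2 : 0 ≤ mean D (fun x => ((Z x - M) *ᵥ a) ⬝ᵥ ((Z x - M) *ᵥ a)) :=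
      Finset.sum_nonneg fun x _ => mul_nonneg ENNReal.toReal_nonneg (zero_le_dotProduct_self _)
    have h3 := mean_mono D fun x => hb x a
    rw [mean_const] at h3
    linarith
  -- Bernstein's choice `t / (σ² + L t / 3)` with `t = wεm`, `σ² = wKm` and `L = 2K`; the factor
  -- `wm` cancels.
  set θ : ℝ := ε / (K * (1 + 2 * ε / 3)) with hθ
  have h1ε : 0 < 1 + 2 * ε / 3 := by positivity
  have hθ0 : 0 < θ := by positivity
  have hθK : 1 - θ * (2 * K) / 3 = 1 / (1 + 2 * ε / 3) := by
    rw [hθ]; field_simp; ring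
  have hθL : θ * (2 * K) < 3 := by
    have : 0 < 1 / (1 + 2 * ε / 3) := by positivity
    linarith
  have hmain := mean_iid_opNorm_sum_le D (Z := fun x => Z x - M) (L := 2 * K) (v := K * m)
    (θ := θ) (t := w * (ε * m))
    (fun i j => by
      have := mean_add D (fun x => Z x i j) (fun _ => -M i j)
      rw [mean_const, hM, add_neg_cancel] at this
      simpa [sub_eq_add_neg] using this) hθ0 (by positivity) hθL (by positivity)
    (fun x a => by
      rw [sub_mulVec]
      have := dotProduct_sub_self_le (Z x *ᵥ a) (M *ᵥ a)
      linarith [hb x a, hMb a])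
    (fun a => by
      rw [hsq Z M hM a]
      linarith [hv a, zero_le_dotProduct_self (M *ᵥ a)])
    (fun a => by
      simp only [transpose_sub]
      rw [hsq (fun x => (Z x)ᵀ) Mᵀ hMt a]
      linarith [hv' a, zero_le_dotProduct_self (Mᵀ *ᵥ a)]) w
  have hset : {x : Fin w → X | opNorm (∑ i, (Z (x i) - M)) ≤ w * (ε * m)}
      = {x : Fin w → X | opNorm (M - (1 / (w : ℝ)) • ∑ i, Z (x i)) ≤ ε * m} := by
    ext x
    have e : ∑ i, (Z (x i) - M) = (-(w : ℝ)) • (M - (1 / (w : ℝ)) • ∑ i, Z (x i)) := by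
      rw [Finset.sum_sub_distrib, Finset.sum_const, Finset.card_univ, Fintype.card_fin, smul_sub,
        smul_smul, neg_mul, mul_one_div_cancel hw'.ne', ← Nat.cast_smul_eq_nsmul ℝ]
      simp only [neg_smul, one_smul]
      abel
    simp only [Set.mem_ofPred_eq]
    rw [e, opNorm, map_smul, norm_smul, norm_neg, Real.norm_of_nonneg hw'.le, ← opNorm]
    exact mul_le_mul_iff_right₀ hw'
  rw [hset] at hmain
  refine hmain.trans ?_
  have hexp : w * (K * m * θ ^ 2 * (1 / (2 * (1 - θ * (2 * K) / 3)))) - θ * (w * (ε * m))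
      = -(w * m * (3 * ε ^ 2) / (K * (6 + 4 * ε))) := by
    rw [hθK, hθ]
    have : (6 + 4 * ε) = 6 * (1 + 2 * ε / 3) := by ring
    rw [this]
    field_simp
    ring
  -- The exponent still carries the factor `m`; as `1 ≤ m` it may be dropped, so the required `w`
  -- does not involve `m`.
  have hlog : Real.log (2 * l / p) ≤ w * m * (3 * ε ^ 2) / (K * (6 + 4 * ε)) := by
    rw [le_div_iff₀ (by positivity)]
    rw [div_le_iff₀ (by positivity)] at hwK
    have h2 : (w : ℝ) * (3 * ε ^ 2) * 1 ≤ w * (3 * ε ^ 2) * m :=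
      mul_le_mul_of_nonneg_left hm (by positivity)
    linarith
  rw [hexp]
  calc 2 * l * Real.exp (-(w * m * (3 * ε ^ 2) / (K * (6 + 4 * ε))))
      ≤ 2 * l * Real.exp (-Real.log (2 * l / p)) :=
        mul_le_mul_of_nonneg_left (Real.exp_le_exp.2 (neg_le_neg hlog)) (by positivity)
    _ = p := by
        rw [Real.exp_neg, Real.exp_log (by positivity)]
        field_simp

end Concentration

end PPR

/-! ### The PageRank matrix as `α (1 - (1 - α) P)⁻¹` -/

namespace PPR

open Matrix

variable {V : Type*} [Fintype V] [DecidableEq V]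
variable {G : Digraph V} [DecidableRel G.Adj] {α : ℝ}

theorem isDist_single (v : V) : IsDist (Pi.single v (1 : ℝ)) := by
  refine ⟨fun u => ?_, by simp⟩
  rw [Pi.single_apply]
  split_ifs <;> norm_num

theorem pprMatrix_nonneg (hα0 : 0 < α) (hα1 : α < 1) (hout : ∀ v, 0 < outDeg G v) (v u : V) :
    0 ≤ pprMatrix G α v u :=
  (isPPR_ppr hα0 hα1 hout (isDist_single v)).1.1 u

/-- Row `v` is the stationarity equation of `π_v`, whose restart term is `α e_v` because the entries
of `π_v` sum to `1`. -/
theorem pprMatrix_mul (hα0 : 0 < α) (hα1 : α < 1) (hout : ∀ v, 0 < outDeg G v) :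
    pprMatrix G α * (1 - (1 - α) • walkMatrix G) = α • (1 : Matrix V V ℝ) := by
  ext v u
  have h := isPPR_ppr hα0 hα1 hout (isDist_single (V := V) v)
  have h2 := congrFun h.2 u
  rw [vecMul_pprChain, h.1.2] at h2
  rw [mul_sub, mul_one, Matrix.mul_smul, Matrix.sub_apply, Matrix.smul_apply,
    Matrix.smul_apply, Matrix.one_apply]
  have h3 : (pprMatrix G α * walkMatrix G) v u
      = (ppr G α (Pi.single v 1) ᵥ* walkMatrix G) u := rfl
  have h4 : pprMatrix G α v u = ppr G α (Pi.single v 1) u := rfl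
  rw [h3, h4]
  simp only [Pi.add_apply, Pi.smul_apply, smul_eq_mul, mul_one, Pi.single_apply] at h2 ⊢
  rw [← h2]
  simp only [eq_comm (a := u)]
  simp

theorem mul_pprMatrix (hα0 : 0 < α) (hα1 : α < 1) (hout : ∀ v, 0 < outDeg G v) :
    (1 - (1 - α) • walkMatrix G) * pprMatrix G α = α • (1 : Matrix V V ℝ) := by
  have h : (α⁻¹ • pprMatrix G α) * (1 - (1 - α) • walkMatrix G) = 1 := by
    rw [smul_mul, pprMatrix_mul hα0 hα1 hout, smul_smul, inv_mul_cancel₀ hα0.ne', one_smul]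
  have h' := congrArg (fun M => α • M) (mul_eq_one_comm.1 h)
  simpa only [Matrix.mul_smul, smul_smul, mul_inv_cancel₀ hα0.ne', one_smul] using h'

/-- The first-step equation `Π = α + (1 - α) P Π`. -/
theorem pprMatrix_eq (hα0 : 0 < α) (hα1 : α < 1) (hout : ∀ v, 0 < outDeg G v) :
    pprMatrix G α = α • (1 : Matrix V V ℝ) + (1 - α) • (walkMatrix G * pprMatrix G α) := by
  have h := mul_pprMatrix hα0 hα1 hout
  rw [sub_mul, one_mul, smul_mul, sub_eq_iff_eq_add] at h
  exact h

/-- The last-step equation `Π = α + (1 - α) Π P`. -/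
theorem pprMatrix_eq' (hα0 : 0 < α) (hα1 : α < 1) (hout : ∀ v, 0 < outDeg G v) :
    pprMatrix G α = α • (1 : Matrix V V ℝ) + (1 - α) • (pprMatrix G α * walkMatrix G) := by
  have h := pprMatrix_mul hα0 hα1 hout
  rw [mul_sub, mul_one, Matrix.mul_smul, sub_eq_iff_eq_add] at h
  exact h

/-! ### Invariants of the updates -/

theorem update_add_eq_add_single {V : Type*} [DecidableEq V] (f : V → ℝ) (v : V) (c : ℝ) :
    Function.update f v (f v + c) = f + c • Pi.single v 1 := by
  ext u
  by_cases h : u = v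
  · subst h; simp
  · simp [h]

/-- Without self-loops row `v` of `P` vanishes at `v`, so resetting `r v` to `0` is the same as
subtracting `r v • e_v`. The update thus becomes a linear expression to which `Π` can be applied. -/
theorem pushForward_r (hloop : ∀ v, ¬ G.Adj v v) (x : DPState V) (v : V) :
    (pushForward G α x v).r
      = x.r - x.r v • Pi.single v 1 + ((1 - α) * x.r v) • (walkMatrix G).row v := by
  ext u
  simp only [pushForward, walkMatrix, Pi.add_apply, Pi.sub_apply, Pi.smul_apply, smul_eq_mul,
    Pi.single_apply, row_apply, of_apply]
  by_cases h : u = v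
  · subst h; simp [hloop]
  · by_cases h' : G.Adj v u
    · simp [h, h']; ring
    · simp [h, h']

theorem pushBackward_r (hloop : ∀ v, ¬ G.Adj v v) (x : DPState V) (v : V) :
    (pushBackward G α x v).r
      = x.r - x.r v • Pi.single v 1 + ((1 - α) * x.r v) • (walkMatrix G).col v := by
  ext u
  simp only [pushBackward, walkMatrix, Pi.add_apply, Pi.sub_apply, Pi.smul_apply, smul_eq_mul,
    Pi.single_apply, col_apply, of_apply]
  by_cases h : u = v
  · subst h; simp [hloop]
  · by_cases h' : G.Adj u v
    · simp [h, h']; ring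
    · simp [h, h']

/-- The invariant of the forward dynamic program with source `s`. -/
structure ForwardInv (G : Digraph V) [DecidableRel G.Adj] (α : ℝ) (s : V) (x : DPState V) :
    Prop where
  p_nonneg : ∀ v, 0 ≤ x.p v
  r_nonneg : ∀ v, 0 ≤ x.r v
  eq : x.p + x.r ᵥ* pprMatrix G α = (pprMatrix G α).row s

/-- The invariant of the backward dynamic program with target `t`. -/
structure BackwardInv (G : Digraph V) [DecidableRel G.Adj] (α : ℝ) (t : V) (x : DPState V) :
    Prop where
  p_nonneg : ∀ v, 0 ≤ x.p v
  r_nonneg : ∀ v, 0 ≤ x.r v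
  eq : x.p + pprMatrix G α *ᵥ x.r = (pprMatrix G α).col t

theorem forwardInv_init (s : V) : ForwardInv G α s (DPState.init s) where
  p_nonneg _ := le_rfl
  r_nonneg := (isDist_single s).1
  eq := by simp [DPState.init]

theorem backwardInv_init (t : V) : BackwardInv G α t (DPState.init t) where
  p_nonneg _ := le_rfl
  r_nonneg := (isDist_single t).1
  eq := by simp [DPState.init]

/-- By the first-step equation, mass at `v` may be exchanged for `α` of it in `p` and `1 - α` of it
spread along `P(v,·)` in `r`. -/
theorem ForwardInv.push (hα0 : 0 < α) (hα1 : α < 1) (hout : ∀ v, 0 < outDeg G v)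
    (hloop : ∀ v, ¬ G.Adj v v) {s : V} {x : DPState V} (h : ForwardInv G α s x) (v : V) :
    ForwardInv G α s (pushForward G α x v) where
  p_nonneg u := by
    have := h.p_nonneg u
    have := h.p_nonneg v
    have := mul_nonneg hα0.le (h.r_nonneg v)
    simp only [pushForward, Function.update_apply]
    split_ifs <;> linarith
  r_nonneg u := by
    have hu := h.r_nonneg u
    have hv := h.r_nonneg v
    have : 0 < 1 - α := by linarith
    simp only [pushForward]
    split_ifs <;> positivity
  eq := by
    have hrow : (pprMatrix G α).row v
        = α • Pi.single v 1 + (1 - α) • ((walkMatrix G).row v ᵥ* pprMatrix G α) := by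
      have := congrArg (fun M : Matrix V V ℝ => Pi.single v 1 ᵥ* M) (pprMatrix_eq hα0 hα1 hout)
      simpa [vecMul_add, vecMul_smul, ← vecMul_vecMul] using this
    rw [pushForward_r hloop, ← h.eq]
    simp only [pushForward]
    rw [update_add_eq_add_single, add_vecMul, sub_vecMul, smul_vecMul, smul_vecMul,
      single_one_vecMul, hrow]
    ext u
    simp only [Pi.add_apply, Pi.sub_apply, Pi.smul_apply, smul_eq_mul]
    ring

theorem BackwardInv.push (hα0 : 0 < α) (hα1 : α < 1) (hout : ∀ v, 0 < outDeg G v)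
    (hloop : ∀ v, ¬ G.Adj v v) {t : V} {x : DPState V} (h : BackwardInv G α t x) (v : V) :
    BackwardInv G α t (pushBackward G α x v) where
  p_nonneg u := by
    have := h.p_nonneg u
    have := h.p_nonneg v
    have := mul_nonneg hα0.le (h.r_nonneg v)
    simp only [pushBackward, Function.update_apply]
    split_ifs <;> linarith
  r_nonneg u := by
    have hu := h.r_nonneg u
    have hv := h.r_nonneg v
    have : 0 < 1 - α := by linarith
    simp only [pushBackward]
    split_ifs <;> positivity
  eq := by
    have hcol : (pprMatrix G α).col v
        = α • Pi.single v 1 + (1 - α) • (pprMatrix G α *ᵥ (walkMatrix G).col v) := by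
      have := congrArg (fun M : Matrix V V ℝ => M *ᵥ Pi.single v 1) (pprMatrix_eq' hα0 hα1 hout)
      simp only [add_mulVec, smul_mulVec, one_mulVec, ← mulVec_mulVec] at this
      simpa only [mulVec_single_one] using this
    rw [pushBackward_r hloop, ← h.eq]
    simp only [pushBackward]
    rw [update_add_eq_add_single, mulVec_add, mulVec_sub, mulVec_smul, mulVec_smul,
      mulVec_single_one, hcol]
    ext u
    simp only [Pi.add_apply, Pi.sub_apply, Pi.smul_apply, smul_eq_mul]
    ring

/-- The identity for `y` replaces `Π e_v` by `y.p + Π y.r`. At `v` itself the new residual is `x.r v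
* y.r v`, so nonnegativity survives the subtraction of `e_v`. -/
theorem BackwardInv.merge {t v : V} {x y : DPState V} (h : BackwardInv G α t x)
    (hy : BackwardInv G α v y) : BackwardInv G α t (merge x v y) where
  p_nonneg u := by
    have := h.p_nonneg u
    have := mul_nonneg (h.r_nonneg v) (hy.p_nonneg u)
    simp only [PPR.merge, Pi.add_apply, Pi.smul_apply, smul_eq_mul]
    linarith
  r_nonneg u := by
    have := h.r_nonneg u
    have := mul_nonneg (h.r_nonneg v) (hy.r_nonneg u)
    simp only [PPR.merge, Pi.add_apply, Pi.smul_apply, Pi.sub_apply, smul_eq_mul, Pi.single_apply]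
    split_ifs with huv
    · subst huv; linarith
    · linarith
  eq := by
    simp only [PPR.merge]
    rw [mulVec_add, mulVec_smul, mulVec_sub, mulVec_single_one, ← hy.eq, ← h.eq]
    ext u
    simp only [Pi.add_apply, Pi.sub_apply, Pi.smul_apply, smul_eq_mul]
    ring

theorem IsForwardOutput.inv (hα0 : 0 < α) (hα1 : α < 1) (hout : ∀ v, 0 < outDeg G v)
    (hloop : ∀ v, ¬ G.Adj v v) {rmax : ℝ} {s : V} {x : DPState V}
    (h : IsForwardOutput G α rmax s x) : ForwardInv G α s x := by
  obtain ⟨h, -⟩ := h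
  induction h with
  | refl => exact forwardInv_init s
  | tail _ hs ih =>
    obtain ⟨-, v, -, rfl⟩ := hs
    exact ih.push hα0 hα1 hout hloop v

/-- Either no iteration has been carried out, or `p(t) ≥ α`. -/
def Started (α : ℝ) (t : V) (x : DPState V) : Prop := x = DPState.init t ∨ α ≤ x.p t

/-- `Started` guarantees that later merges make progress. From `r = e_{t_i}` the only maximizer is
`t_i`, which by injectivity is no earlier target; so the first iteration is a push and sets `p (t i)
= α`. Afterwards `p` never decreases. -/
theorem BackwardInv.step (hα0 : 0 < α) (hα1 : α < 1) (hout : ∀ v, 0 < outDeg G v)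
    (hloop : ∀ v, ¬ G.Adj v v) {l : ℕ} (t : Fin l ↪ V) {B : Fin l → DPState V} {i : Fin l}
    (hB : ∀ j < i, BackwardInv G α (t j) (B j)) {x y : DPState V}
    (hx : BackwardInv G α (t i) x) (hs : Started α (t i) x) (h : BackwardBody G α t B i x y) :
    BackwardInv G α (t i) y ∧ Started α (t i) y := by
  obtain ⟨v, hv, ⟨j, hj, rfl, rfl⟩ | ⟨hj, rfl⟩⟩ := h
  · refine ⟨hx.merge (hB j hj), ?_⟩
    rcases hs with rfl | hs
    · have h1 := hv (t i)
      have hne : t j ≠ t i := fun h => hj.ne (t.injective h)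
      simp [DPState.init, hne] at h1
      exact absurd h1 (by norm_num)
    · right
      have := mul_nonneg (hx.r_nonneg (t j)) ((hB j hj).p_nonneg (t i))
      simp only [PPR.merge, Pi.add_apply, Pi.smul_apply, smul_eq_mul]
      linarith
  · refine ⟨hx.push hα0 hα1 hout hloop v, Or.inr ?_⟩
    have hrv := mul_nonneg hα0.le (hx.r_nonneg v)
    simp only [pushBackward, Function.update_apply]
    rcases hs with rfl | hs
    · have h1 := hv (t i)
      by_cases hvt : t i = v
      · subst hvt; simp [DPState.init]
      · simp [DPState.init, Ne.symm hvt] at h1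
        exact absurd h1 (by norm_num)
    · split_ifs with hvt
      · subst hvt; linarith
      · exact hs

theorem IsBackwardOutput.inv_of_lt (hα0 : 0 < α) (hα1 : α < 1) (hout : ∀ v, 0 < outDeg G v)
    (hloop : ∀ v, ¬ G.Adj v v) {l : ℕ} (t : Fin l ↪ V) {B : Fin l → DPState V} {i : Fin l}
    {rmax : ℝ} (hB : ∀ j < i, BackwardInv G α (t j) (B j))
    (h : IsBackwardOutput G α rmax t B i) :
    BackwardInv G α (t i) (B i) ∧ Started α (t i) (B i) := by
  obtain ⟨h, -⟩ := h
  generalize B i = z at h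
  induction h with
  | refl => exact ⟨backwardInv_init _, Or.inl rfl⟩
  | tail _ hs ih => exact ih.1.step hα0 hα1 hout hloop t hB ih.2 hs.2

theorem IsBackwardOutput.inv (hα0 : 0 < α) (hα1 : α < 1) (hout : ∀ v, 0 < outDeg G v)
    (hloop : ∀ v, ¬ G.Adj v v) {l : ℕ} (t : Fin l ↪ V) {B : Fin l → DPState V} {rmax : ℝ}
    (i : Fin l) (h : ∀ j ≤ i, IsBackwardOutput G α rmax t B j) :
    BackwardInv G α (t i) (B i) ∧ Started α (t i) (B i) := by
  induction i using WellFoundedLT.induction with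
  | ind i ih =>
    exact (h i le_rfl).inv_of_lt hα0 hα1 hout hloop t fun j hj =>
      (ih j hj fun k hk => h k (hk.trans hj.le)).1

/-! ### Termination -/

theorem WhileTerminates.of_measure {X : Type*} {guard : X → Prop} {body : X → X → Prop}
    (I : X → Prop) (f : X → ℝ) {δ : ℝ} (hδ : 0 < δ) (hf : ∀ x, I x → 0 ≤ f x)
    (hex : ∀ x, I x → guard x → ∃ y, body x y)
    (hstep : ∀ x y, I x → guard x → body x y → I y ∧ f y ≤ f x - δ) {x : X} (hx : I x) :
    WhileTerminates guard body x := by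
  obtain ⟨N, hN⟩ := exists_nat_gt (f x / δ)
  rw [div_lt_iff₀ hδ] at hN
  induction N generalizing x with
  | zero => simp at hN; exact absurd (hf x hx) (not_le.2 hN)
  | succ N ih =>
    by_cases hg : guard x
    · refine .step x hg (hex x hx hg) fun y hy => ?_
      obtain ⟨h1, h2⟩ := hstep x y hx hg hy
      refine ih h1 ?_
      push_cast at hN
      linarith
    · exact .done x hg

/-- A push at `v` destroys the mass `α r(v)`. As `v` maximizes `r / d_out` and degrees lie between
`1` and `|V|`, every `r(u) ≤ |V| r(v)`; so residual mass above `rs` forces `r(v) ≥ rs / |V|²`. -/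
theorem forward_terminates (hα0 : 0 < α) (hα1 : α < 1) (hout : ∀ v, 0 < outDeg G v)
    (hloop : ∀ v, ¬ G.Adj v v) {rs : ℝ} (hrs : 0 < rs) (s : V) :
    WhileTerminates (ForwardGuard rs) (ForwardBody G α) (DPState.init s) := by
  have : Nonempty V := ⟨s⟩
  have hn : (0 : ℝ) < Fintype.card V := by exact_mod_cast Fintype.card_pos
  refine WhileTerminates.of_measure (ForwardInv G α s) (fun x => ∑ v, x.r v)
    (δ := α * (rs / (Fintype.card V * Fintype.card V))) (by positivity)
    (fun x hx => Finset.sum_nonneg fun v _ => hx.r_nonneg v) (fun x _ _ => ?_) ?_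
    (forwardInv_init s)
  · obtain ⟨v, hv⟩ := Finite.exists_max fun v => x.r v / (outDeg G v : ℝ)
    exact ⟨_, v, hv, rfl⟩
  · rintro x y hx hg ⟨v, hv, rfl⟩
    refine ⟨hx.push hα0 hα1 hout hloop v, ?_⟩
    have hd : ∀ u, (0 : ℝ) < outDeg G u := fun u => by exact_mod_cast hout u
    have hsum : ∑ u, (pushForward G α x v).r u = ∑ u, x.r u - α * x.r v := by
      rw [pushForward_r hloop]
      simp only [Pi.add_apply, Pi.sub_apply, Pi.smul_apply, smul_eq_mul, row_apply,
        Finset.sum_add_distrib, Finset.sum_sub_distrib, ← Finset.mul_sum, sum_walkMatrix hout,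
        Finset.sum_pi_single', Finset.mem_univ, if_true]
      ring
    have hru : ∀ u, x.r u ≤ Fintype.card V * x.r v := fun u => by
      have h1 := hv u
      rw [div_le_iff₀ (hd u)] at h1
      have h2 : x.r v / (outDeg G v : ℝ) ≤ x.r v :=
        div_le_self (hx.r_nonneg v) (by exact_mod_cast hout v)
      have h3 : (outDeg G u : ℝ) ≤ Fintype.card V := by
        exact_mod_cast Finset.card_le_univ _
      calc x.r u ≤ x.r v / (outDeg G v : ℝ) * outDeg G u := h1
        _ ≤ x.r v * Fintype.card V := mul_le_mul h2 h3 (hd u).le (hx.r_nonneg v)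
        _ = _ := mul_comm _ _
    have hrs' : rs < Fintype.card V * (Fintype.card V * x.r v) := by
      refine lt_of_lt_of_le hg ?_
      calc ∑ u, |x.r u| ≤ ∑ _u : V, Fintype.card V * x.r v :=
            Finset.sum_le_sum fun u _ => by rw [abs_of_nonneg (hx.r_nonneg u)]; exact hru u
        _ = _ := by rw [Finset.sum_const, Finset.card_univ, nsmul_eq_mul]
    have : rs / (Fintype.card V * Fintype.card V) ≤ x.r v := by
      rw [div_le_iff₀ (by positivity)]
      linarith
    rw [hsum]
    have := mul_le_mul_of_nonneg_left this hα0.le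
    linarith

theorem backward_terminates (hα0 : 0 < α) (hα1 : α < 1) (hout : ∀ v, 0 < outDeg G v)
    (hloop : ∀ v, ¬ G.Adj v v) {rt : ℝ} (hrt : 0 < rt) {l : ℕ} (t : Fin l ↪ V)
    (B : Fin l → DPState V) (i : Fin l) (hB : ∀ j < i, IsBackwardOutput G α rt t B j) :
    WhileTerminates (BackwardGuard rt) (BackwardBody G α t B i) (DPState.init (t i)) := by
  have : Nonempty V := ⟨t i⟩
  -- For `rt ≥ 1` no iteration takes place. In the other case the initial state still satisfies the
  -- guard, so no earlier result is an initial state and each satisfies `α ≤ p (t j)`.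
  by_cases hrt1 : rt < 1
  swap
  · refine .done _ ?_
    simp only [BackwardGuard, DPState.init, not_lt]
    refine (pi_norm_le_iff_of_nonneg hrt.le).2 fun u => ?_
    rw [Pi.single_apply]
    split_ifs <;> simp <;> linarith
  have hinv : ∀ j < i, BackwardInv G α (t j) (B j) ∧ Started α (t j) (B j) := fun j hj =>
    IsBackwardOutput.inv hα0 hα1 hout hloop t j fun k hk => hB k (hk.trans_lt hj)
  have hstart : ∀ j < i, α ≤ (B j).p (t j) := fun j hj => by
    rcases (hinv j hj).2 with h | h
    · refine absurd ?_ (hB j hj).2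
      rw [h, BackwardGuard]
      refine lt_of_lt_of_le hrt1 ?_
      have := norm_le_pi_norm (DPState.init (t j)).r (t j)
      simpa [DPState.init] using this
    · exact h
  refine WhileTerminates.of_measure
    (fun x => BackwardInv G α (t i) x ∧ Started α (t i) x)
    (fun x => ∑ v, (pprMatrix G α v (t i) - x.p v)) (δ := rt * α) (by positivity) ?_ ?_ ?_
    ⟨backwardInv_init _, Or.inl rfl⟩
  · rintro x ⟨hx, -⟩
    refine Finset.sum_nonneg fun v _ => ?_
    have h1 := congrFun hx.eq v
    have h2 : 0 ≤ (pprMatrix G α *ᵥ x.r) v :=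
      Finset.sum_nonneg fun u _ => mul_nonneg (pprMatrix_nonneg hα0 hα1 hout v u) (hx.r_nonneg u)
    simp only [Pi.add_apply, col_apply] at h1
    linarith
  · rintro x - -
    obtain ⟨v, hv⟩ := Finite.exists_max x.r
    by_cases h : ∃ j < i, t j = v
    · obtain ⟨j, hj, hjv⟩ := h
      exact ⟨_, v, hv, Or.inl ⟨j, hj, hjv, rfl⟩⟩
    · push Not at h
      exact ⟨_, v, hv, Or.inr ⟨h, rfl⟩⟩
  · rintro x y ⟨hx, hxs⟩ hg hy
    refine ⟨hx.step hα0 hα1 hout hloop t (fun j hj => (hinv j hj).1) hxs hy, ?_⟩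
    obtain ⟨v, hv, hc⟩ := hy
    have hrv : rt ≤ x.r v := by
      refine hg.le.trans ((pi_norm_le_iff_of_nonneg (hx.r_nonneg v)).2 fun u => ?_)
      rw [Real.norm_of_nonneg (hx.r_nonneg u)]
      exact hv u
    simp only [Finset.sum_sub_distrib]
    -- A push adds `α r(v)` to the mass of `p`, and a merge adds `r(v)` times the mass of the
    -- earlier `p`, which is at least `α`.
    suffices h : ∑ u, x.p u + rt * α ≤ ∑ u, y.p u by linarith
    rcases hc with ⟨j, hj, rfl, rfl⟩ | ⟨-, rfl⟩
    · simp only [PPR.merge, Pi.add_apply, Pi.smul_apply, smul_eq_mul, Finset.sum_add_distrib,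
        ← Finset.mul_sum]
      have h1 : α ≤ ∑ u, (B j).p u := (hstart j hj).trans
        (Finset.single_le_sum (fun u _ => (hinv j hj).1.p_nonneg u) (Finset.mem_univ (t j)))
      have := mul_le_mul hrv h1 hα0.le (hx.r_nonneg _)
      linarith
    · simp only [pushBackward]
      rw [update_add_eq_add_single]
      simp only [Pi.add_apply, Pi.smul_apply, smul_eq_mul, Finset.sum_add_distrib,
        ← Finset.mul_sum, Finset.sum_pi_single', Finset.mem_univ, if_true]
      have := mul_le_mul_of_nonneg_right hrv hα0.le
      linarith

end PPR

/-! ### The law of the sampled walk and unbiasedness -/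

namespace PPR

open Matrix

variable {V : Type*} [Fintype V] [DecidableEq V]
variable {G : Digraph V} [DecidableRel G.Adj] {α : ℝ}

theorem toReal_walkEnd (hout : ∀ v, 0 < outDeg G v) (k : ℕ) (v u : V) :
    (walkEnd G hout k v u).toReal = (walkMatrix G ^ k) v u := by
  induction k generalizing v with
  | zero =>
    simp only [walkEnd, PMF.pure_apply, pow_zero, Matrix.one_apply, eq_comm (a := v)]
    split_ifs <;> simp
  | succ k ih =>
    rw [walkEnd, PMF.bind_apply, tsum_fintype, pow_succ', mul_apply,
      ENNReal.toReal_sum fun x _ => ENNReal.mul_ne_top (PMF.apply_ne_top _ _)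
        (PMF.apply_ne_top _ _)]
    refine Finset.sum_congr rfl fun x _ => ?_
    rw [ENNReal.toReal_mul, ih, PMF.uniformOfFinset_apply]
    congr 1
    simp only [walkMatrix, of_apply, outNbrs, outDeg, Finset.mem_filter, Finset.mem_univ, true_and]
    split_ifs <;> simp

theorem walkMatrix_pow_nonneg (k : ℕ) (v u : V) : 0 ≤ (walkMatrix G ^ k) v u := by
  induction k generalizing v with
  | zero =>
    rw [pow_zero, Matrix.one_apply]; split_ifs <;> norm_num
  | succ k ih =>
    rw [pow_succ', mul_apply]
    exact Finset.sum_nonneg fun x _ => mul_nonneg (walkMatrix_nonneg v x) (ih x)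

theorem walkMatrix_pow_le_one (hout : ∀ v, 0 < outDeg G v) (k : ℕ) (v u : V) :
    (walkMatrix G ^ k) v u ≤ 1 := by
  rw [← toReal_walkEnd hout]
  exact ENNReal.toReal_le_of_le_ofReal zero_le_one (by simpa using PMF.coe_le_one _ _)

/-- Personalized PageRank as the law of the endpoint of a geometric random walk. -/
theorem hasSum_pprMatrix (hα0 : 0 < α) (hα1 : α < 1) (hout : ∀ v, 0 < outDeg G v) (v u : V) :
    HasSum (fun k : ℕ => α * (1 - α) ^ k * (walkMatrix G ^ k) v u) (pprMatrix G α v u) := by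
  have hsum : ∀ v u, Summable fun k : ℕ => α * (1 - α) ^ k * (walkMatrix G ^ k) v u := by
    intro v u
    refine Summable.of_nonneg_of_le
      (fun k => mul_nonneg (mul_nonneg hα0.le (pow_nonneg (by linarith) k))
        (walkMatrix_pow_nonneg k v u))
      (fun k => mul_le_of_le_one_right (mul_nonneg hα0.le (pow_nonneg (by linarith) k))
        (walkMatrix_pow_le_one hout k v u))
      ((summable_geometric_of_lt_one (r := 1 - α) (by linarith) (by linarith)).mul_left α)
  set Q : Matrix V V ℝ := of fun v u => ∑' k : ℕ, α * (1 - α) ^ k * (walkMatrix G ^ k) v u with hQ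
  -- Splitting off the term `k = 0` gives the first-step equation for the series, and invertibility
  -- of `1 - (1 - α) P` identifies it with `Π`.
  have hrec : Q = α • (1 : Matrix V V ℝ) + (1 - α) • (walkMatrix G * Q) := by
    ext v u
    have h1 : Q v u = ∑' k : ℕ, α * (1 - α) ^ k * (walkMatrix G ^ k) v u := rfl
    rw [h1, (hsum v u).tsum_eq_zero_add]
    simp only [Matrix.add_apply, Matrix.smul_apply, smul_eq_mul, pow_zero, mul_one]
    congr 1
    rw [mul_apply, Finset.mul_sum]
    simp only [hQ, of_apply]
    simp only [← tsum_mul_left]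
    rw [← Summable.tsum_finsetSum fun x _ => ((hsum x u).mul_left _).mul_left _]
    refine tsum_congr fun k => ?_
    rw [pow_succ' (walkMatrix G), mul_apply, Finset.mul_sum]
    exact Finset.sum_congr rfl fun x _ => by ring
  have hfix : (1 - (1 - α) • walkMatrix G) * Q = α • (1 : Matrix V V ℝ) := by
    rw [sub_mul, one_mul, smul_mul, sub_eq_iff_eq_add]
    exact hrec
  have hPQ : pprMatrix G α = Q := by
    have h1 : pprMatrix G α * ((1 - (1 - α) • walkMatrix G) * Q) = α • pprMatrix G α := by
      rw [hfix, Matrix.mul_smul, mul_one]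
    rw [← mul_assoc, pprMatrix_mul hα0 hα1 hout, smul_mul, one_mul] at h1
    exact ((smul_right_injective _ hα0.ne') h1).symm
  rw [hPQ]
  exact (hsum v u).hasSum

theorem toReal_sampleWalk (hα0 : 0 < α) (hα1 : α < 1) (hout : ∀ v, 0 < outDeg G v) {σ : V → ℝ}
    (hσ : IsDist σ) (m : V × V) :
    (sampleWalk G hout α hα0 hα1 hσ.toPMF m).toReal = σ m.1 * pprMatrix G α m.1 m.2 := by
  obtain ⟨a, b⟩ := m
  have hmap : ∀ L x, (PMF.map (fun ν => (x, ν)) (walkEnd G hout L x)) (a, b)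
      = if x = a then walkEnd G hout L a b else 0 := by
    intro L x
    rw [PMF.map_apply, tsum_fintype]
    by_cases hx : x = a
    · subst hx
      simp
    · simp [hx, Ne.symm hx]
  have hgeo : ∀ x, ((geom α hα0 hα1).bind fun L =>
      (walkEnd G hout L x).map fun ν => (x, ν)) (a, b)
      = if x = a then ENNReal.ofReal (pprMatrix G α a b) else 0 := by
    intro x
    rw [PMF.bind_apply]
    simp only [hmap]
    split_ifs with hx
    · rw [← (hasSum_pprMatrix hα0 hα1 hout a b).tsum_eq, ENNReal.ofReal_tsum_of_nonneg
        (fun k => mul_nonneg (mul_nonneg hα0.le (pow_nonneg (by linarith) k))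
          (walkMatrix_pow_nonneg k a b)) (hasSum_pprMatrix hα0 hα1 hout a b).summable]
      refine tsum_congr fun k => ?_
      rw [ENNReal.ofReal_mul (mul_nonneg hα0.le (pow_nonneg (by linarith) k)),
        ← toReal_walkEnd hout, ENNReal.ofReal_toReal (PMF.apply_ne_top _ _)]
      rfl
    · simp
  rw [sampleWalk, PMF.bind_apply, tsum_fintype]
  simp only [hgeo]
  rw [Finset.sum_eq_single a (fun x _ hx => by simp [hx]) (by simp), if_pos rfl,
    ENNReal.toReal_mul, ENNReal.toReal_ofReal (pprMatrix_nonneg hα0 hα1 hout a b)]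
  congr 1
  exact ENNReal.toReal_ofReal (hσ.1 a)

variable {l : ℕ}

theorem sampleMatrix_apply (F B : Fin l → DPState V) (σ : V → ℝ) (m : V × V) (i j : Fin l) :
    sampleMatrix F B σ m i j = (F i).r m.1 / σ m.1 * (B j).r m.2 := by
  rw [sampleMatrix, mul_vecMulVec, vecMulVec_mul, vecMulVec_apply, ← mulVec_mulVec,
    diagonal_mulVec_single, mul_one, mulVec_single, single_one_vecMul]
  simp [rMatrix, div_eq_mul_inv]

/-- The decomposition `Π(S,T) = P_T(S,:) + P_Sᵀ R_T + R_Sᵀ Π R_T`. -/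
theorem pprMatrix_submatrix_eq {s t : Fin l → V} {F B : Fin l → DPState V}
    (hF : ∀ i, ForwardInv G α (s i) (F i)) (hB : ∀ i, BackwardInv G α (t i) (B i)) :
    (pprMatrix G α).submatrix s t = (pMatrix B).submatrix s id + (pMatrix F)ᵀ * rMatrix B
      + (rMatrix F)ᵀ * pprMatrix G α * rMatrix B := by
  ext i j
  have h1 := congrFun (hB j).eq (s i)
  have h2 := congrArg (fun x => x ⬝ᵥ (B j).r) (hF i).eq
  simp only [add_dotProduct, Pi.add_apply, col_apply] at h1 h2
  rw [submatrix_apply, ← h1, Matrix.add_apply, Matrix.add_apply, add_assoc]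
  congr 1
  rw [mulVec, show (fun j => pprMatrix G α (s i) j) = (pprMatrix G α).row (s i) from rfl, ← h2]
  rfl

/-- The weight `1/σ(μ)` cancels the sampling probability. Where `σ` vanishes the weight is `0`, and
no mass is lost because the residuals vanish there too. -/
theorem mean_sampleMatrix (hα0 : 0 < α) (hα1 : α < 1) (hout : ∀ v, 0 < outDeg G v) {σ : V → ℝ}
    (hσ : IsDist σ) {F B : Fin l → DPState V} (hσF : ∀ i v, σ v = 0 → (F i).r v = 0)
    (i j : Fin l) :
    mean (sampleWalk G hout α hα0 hα1 hσ.toPMF) (fun m => sampleMatrix F B σ m i j)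
      = ((rMatrix F)ᵀ * pprMatrix G α * rMatrix B) i j := by
  simp only [mean, toReal_sampleWalk, sampleMatrix_apply, Fintype.sum_prod_type]
  rw [mul_apply]
  simp only [mul_apply, Finset.sum_mul, transpose_apply, rMatrix, of_apply]
  rw [Finset.sum_comm]
  refine Finset.sum_congr rfl fun a _ => Finset.sum_congr rfl fun b _ => ?_
  by_cases h : σ b = 0
  · simp [h, hσF i b h]
  · field_simp

end PPR

/-! ### Norms and second moments of rank-one matrices -/

namespace PPR

open Matrix

variable {l : ℕ}

theorem dotProduct_sq_le (a b : Fin l → ℝ) : (a ⬝ᵥ b) ^ 2 ≤ (a ⬝ᵥ a) * (b ⬝ᵥ b) := by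
  simpa [dotProduct, sq] using Finset.sum_mul_sq_le_sq_mul_sq Finset.univ a b

theorem norm_toLp_eq_sqrt (a : Fin l → ℝ) :
    ‖(WithLp.toLp 2 a : EuclideanSpace ℝ (Fin l))‖ = √(a ⬝ᵥ a) := by
  rw [← norm_toLp_sq, Real.sqrt_sq (norm_nonneg _)]

theorem dotProduct_mulVec_le_opNorm (A : Matrix (Fin l) (Fin l) ℝ) (a b : Fin l → ℝ) :
    a ⬝ᵥ A *ᵥ b ≤ √(a ⬝ᵥ a) * (opNorm A * √(b ⬝ᵥ b)) := by
  have h := inner_toEuclideanCLM A (WithLp.toLp 2 a) (WithLp.toLp 2 b)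
  rw [← norm_toLp_eq_sqrt, ← norm_toLp_eq_sqrt]
  refine (le_of_eq h.symm).trans ((real_inner_le_norm _ _).trans ?_)
  exact mul_le_mul_of_nonneg_left (ContinuousLinearMap.le_opNorm _ _) (norm_nonneg _)

theorem opNorm_le_frobNorm (A : Matrix (Fin l) (Fin l) ℝ) : opNorm A ≤ frobNorm A := by
  refine ContinuousLinearMap.opNorm_le_bound _ (Real.sqrt_nonneg _) fun x => ?_
  obtain ⟨a, rfl⟩ : ∃ a, x = WithLp.toLp 2 a := ⟨x.ofLp, rfl⟩
  have hA : 0 ≤ ∑ i, ∑ j, A i j ^ 2 :=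
    Finset.sum_nonneg fun i _ => Finset.sum_nonneg fun j _ => sq_nonneg _
  rw [toEuclideanCLM_toLp, norm_toLp_eq_sqrt, norm_toLp_eq_sqrt, frobNorm, ← Real.sqrt_mul hA]
  refine Real.sqrt_le_sqrt ?_
  rw [dotProduct, Finset.sum_mul]
  refine Finset.sum_le_sum fun i _ => ?_
  have := dotProduct_sq_le (A i) a
  rw [← sq]
  refine this.trans (le_of_eq ?_)
  simp [dotProduct, sq]

theorem one_le_sqrt_srank {A : Matrix (Fin l) (Fin l) ℝ} (hA : A ≠ 0) : 1 ≤ √(srank A) := by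
  have h0 : 0 < opNorm A := norm_pos_iff.2 fun h => hA (by simpa using h)
  have h1 : 1 ≤ frobNorm A / opNorm A := (one_le_div h0).2 (opNorm_le_frobNorm A)
  rw [srank, Real.sqrt_sq (by linarith)]
  exact h1

section RankOne

variable {X : Type*}

theorem vecMulVec_mulVec_dotProduct_self (x y a : Fin l → ℝ) :
    (vecMulVec x y *ᵥ a) ⬝ᵥ (vecMulVec x y *ᵥ a) = (x ⬝ᵥ x) * (y ⬝ᵥ a) ^ 2 := by
  have : vecMulVec x y *ᵥ a = (y ⬝ᵥ a) • x := by
    ext i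
    simp only [mulVec, dotProduct, vecMulVec_apply, Pi.smul_apply, smul_eq_mul, Finset.sum_mul]
    exact Finset.sum_congr rfl fun j _ => by ring
  rw [this, smul_dotProduct, dotProduct_smul]
  simp only [smul_eq_mul]
  ring

theorem vecMulVec_sq_le {x y a : Fin l → ℝ} {L : ℝ} (hL : (x ⬝ᵥ x) * (y ⬝ᵥ y) ≤ L ^ 2) :
    (vecMulVec x y *ᵥ a) ⬝ᵥ (vecMulVec x y *ᵥ a) ≤ L ^ 2 * (a ⬝ᵥ a) := by
  rw [vecMulVec_mulVec_dotProduct_self]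
  have h1 := mul_le_mul_of_nonneg_left (dotProduct_sq_le y a) (zero_le_dotProduct_self x)
  have h2 := mul_le_mul_of_nonneg_right hL (zero_le_dotProduct_self a)
  linarith

theorem sqrt_dotProduct_self_le_sum {x : Fin l → ℝ} (hx : ∀ i, 0 ≤ x i) :
    √(x ⬝ᵥ x) ≤ ∑ i, x i := by
  refine Real.sqrt_le_iff.2 ⟨Finset.sum_nonneg fun i _ => hx i, ?_⟩
  rw [sq, Finset.sum_mul]
  refine Finset.sum_le_sum fun i _ => mul_le_mul_of_nonneg_left ?_ (hx i)
  exact Finset.single_le_sum (fun j _ => hx j) (Finset.mem_univ i)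

/-- Write `z = √z * √z`. One factor is bounded by `L ‖a‖`; the other by an `ℓ¹` expression linear in
the entries of `x yᵀ`, whose expectation depends only on the mean matrix. -/
theorem vecMulVec_sq_le_form {x y a : Fin l → ℝ} {L : ℝ} (hL0 : 0 ≤ L) (hx : ∀ i, 0 ≤ x i)
    (hy : ∀ i, 0 ≤ y i) (hL : (x ⬝ᵥ x) * (y ⬝ᵥ y) ≤ L ^ 2) :
    (vecMulVec x y *ᵥ a) ⬝ᵥ (vecMulVec x y *ᵥ a)
      ≤ L * √(a ⬝ᵥ a) * ∑ i, ∑ j, |a j| * (x i * y j) := by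
  set z := (vecMulVec x y *ᵥ a) ⬝ᵥ (vecMulVec x y *ᵥ a) with hz
  have hz0 : 0 ≤ z := zero_le_dotProduct_self _
  have h1 : √z ≤ L * √(a ⬝ᵥ a) := by
    refine Real.sqrt_le_iff.2 ⟨by positivity, ?_⟩
    rw [mul_pow, Real.sq_sqrt (zero_le_dotProduct_self a)]
    exact vecMulVec_sq_le hL
  have h2 : √z ≤ ∑ i, ∑ j, |a j| * (x i * y j) := by
    rw [hz, vecMulVec_mulVec_dotProduct_self, Real.sqrt_mul (zero_le_dotProduct_self x),
      Real.sqrt_sq_eq_abs]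
    have h3 : |y ⬝ᵥ a| ≤ ∑ j, y j * |a j| := by
      refine (Finset.abs_sum_le_sum_abs _ _).trans (le_of_eq (Finset.sum_congr rfl fun j _ => ?_))
      rw [abs_mul, abs_of_nonneg (hy j)]
    refine (mul_le_mul (sqrt_dotProduct_self_le_sum hx) h3 (abs_nonneg _)
      (Finset.sum_nonneg fun i _ => hx i)).trans (le_of_eq ?_)
    rw [Finset.sum_mul_sum]
    exact Finset.sum_congr rfl fun i _ => Finset.sum_congr rfl fun j _ => by ring
  calc z = √z * √z := (Real.mul_self_sqrt hz0).symm
    _ ≤ _ := mul_le_mul h1 h2 (Real.sqrt_nonneg _) (by positivity)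

/-- The variance of a random nonnegative rank one matrix `x yᵀ` in terms of the operator norm of
a matrix dominating its mean. -/
theorem mean_vecMulVec_sq_le [Fintype X] (D : PMF X) {x y : X → Fin l → ℝ} {L : ℝ} (hL0 : 0 ≤ L)
    (hx : ∀ m i, 0 ≤ x m i) (hy : ∀ m i, 0 ≤ y m i)
    (hL : ∀ m, (x m ⬝ᵥ x m) * (y m ⬝ᵥ y m) ≤ L ^ 2) {A : Matrix (Fin l) (Fin l) ℝ}
    (hA : ∀ i j, mean D (fun m => x m i * y m j) ≤ A i j) (a : Fin l → ℝ) :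
    mean D (fun m => (vecMulVec (x m) (y m) *ᵥ a) ⬝ᵥ (vecMulVec (x m) (y m) *ᵥ a))
      ≤ L * √l * opNorm A * (a ⬝ᵥ a) := by
  refine (mean_mono D fun m => vecMulVec_sq_le_form hL0 (hx m) (hy m) (hL m)).trans ?_
  rw [mean_mul_left]
  simp only [mean_sum, mean_mul_left]
  -- The averaged linear bound is `1ᵀ A |a|`; the all-ones vector has norm `√l`, the source of the
  -- factor `√l`.
  have h1 : ∑ i, ∑ j, |a j| * mean D (fun m => x m i * y m j)
      ≤ (1 : Fin l → ℝ) ⬝ᵥ A *ᵥ (fun j => |a j|) := by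
    rw [dotProduct]
    refine Finset.sum_le_sum fun i _ => ?_
    rw [Pi.one_apply, one_mul, mulVec, dotProduct]
    refine Finset.sum_le_sum fun j _ => ?_
    rw [mul_comm]
    exact mul_le_mul_of_nonneg_right (hA i j) (abs_nonneg _)
  have h2 := h1.trans (dotProduct_mulVec_le_opNorm A 1 fun j => |a j|)
  have h3 : (fun j => |a j|) ⬝ᵥ (fun j => |a j|) = a ⬝ᵥ a := by simp [dotProduct]
  have h4 : (1 : Fin l → ℝ) ⬝ᵥ 1 = l := by simp [dotProduct]
  rw [h3, h4] at h2
  refine (mul_le_mul_of_nonneg_left h2 (by positivity)).trans (le_of_eq ?_)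
  have h5 := Real.mul_self_sqrt (zero_le_dotProduct_self a)
  calc L * √(a ⬝ᵥ a) * (√l * (opNorm A * √(a ⬝ᵥ a)))
      = L * √l * opNorm A * (√(a ⬝ᵥ a) * √(a ⬝ᵥ a)) := by ring
    _ = _ := by rw [h5]

end RankOne

theorem mem_support_of_mem_support_iid {X : Type*} {D : PMF X} {w : ℕ} {m : Fin w → X}
    (hm : m ∈ (iid D w).support) (i : Fin w) : m i ∈ D.support := by
  induction w with
  | zero => exact i.elim0
  | succ w ih =>
    simp only [iid, PMF.mem_support_bind_iff, PMF.mem_support_map_iff] at hm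
    obtain ⟨x, hx, xs, hxs, rfl⟩ := hm
    refine Fin.cases ?_ (fun j => ?_) i
    · simpa using hx
    · simpa using ih hxs j

/-! ### Accuracy of the estimator -/

section Estimate

variable {V : Type*} [Fintype V] [DecidableEq V]
variable {G : Digraph V} [DecidableRel G.Adj] {α : ℝ}

theorem sub_estimate {s t : Fin l → V} {F B : Fin l → DPState V}
    (hF : ∀ i, ForwardInv G α (s i) (F i)) (hB : ∀ i, BackwardInv G α (t i) (B i)) (σ : V → ℝ)
    {w : ℕ} (m : Fin w → V × V) :
    (pprMatrix G α).submatrix s t - estimate s F B σ m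
      = (rMatrix F)ᵀ * pprMatrix G α * rMatrix B
        - (1 / (w : ℝ)) • ∑ i, sampleMatrix F B σ (m i) := by
  rw [pprMatrix_submatrix_eq hF hB, estimate]
  abel

/-- The deterministic part of the estimate is entrywise nonnegative. This brings `Π(S,T)` into the
second-moment bound in place of the mean of the samples. -/
theorem residual_le_submatrix {s t : Fin l → V} {F B : Fin l → DPState V}
    (hF : ∀ i, ForwardInv G α (s i) (F i)) (hB : ∀ i, BackwardInv G α (t i) (B i)) (i j : Fin l) :
    ((rMatrix F)ᵀ * pprMatrix G α * rMatrix B) i j ≤ (pprMatrix G α).submatrix s t i j := by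
  rw [pprMatrix_submatrix_eq hF hB, Matrix.add_apply, Matrix.add_apply]
  have h1 : 0 ≤ (pMatrix B).submatrix s id i j := (hB j).p_nonneg (s i)
  have h2 : 0 ≤ ((pMatrix F)ᵀ * rMatrix B) i j :=
    Finset.sum_nonneg fun v _ => mul_nonneg ((hF i).p_nonneg v) ((hB j).r_nonneg v)
  linarith

theorem sampleMatrix_eq_vecMulVec (F B : Fin l → DPState V) (σ : V → ℝ) (m : V × V) :
    sampleMatrix F B σ m
      = vecMulVec (fun i => (F i).r m.1 / σ m.1) (fun j => (B j).r m.2) := by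
  ext i j
  rw [sampleMatrix_apply, vecMulVec_apply]

/-- Accuracy of the estimate, for any start distribution for which the samples are bounded
by `L`. -/
theorem le_estimateLaw_accurate (hα0 : 0 < α) (hα1 : α < 1) (hout : ∀ v, 0 < outDeg G v)
    {s t : Fin l → V} {F B : Fin l → DPState V} (hl : 0 < l)
    (hF : ∀ i, ForwardInv G α (s i) (F i)) (hB : ∀ i, BackwardInv G α (t i) (B i)) {σ : V → ℝ}
    (hσ : IsDist σ) (hσF : ∀ i v, σ v = 0 → (F i).r v = 0) {L : ℝ} (hL0 : 0 < L)
    (hL : ∀ v u, ((fun i => (F i).r v / σ v) ⬝ᵥ fun i => (F i).r v / σ v)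
      * ((fun j => (B j).r u) ⬝ᵥ fun j => (B j).r u) ≤ L ^ 2)
    {ε p : ℝ} (hε : 0 < ε) (hp0 : 0 < p) {w : ℕ} (hw : 0 < w)
    (hwL : L * √l * Real.log (2 * l / p) * (6 + 4 * ε) / (3 * ε ^ 2) ≤ w) :
    ENNReal.ofReal (1 - p) ≤ (estimateLaw G hout α hα0 hα1 s F B hσ w).toOuterMeasure
      (accurate ((pprMatrix G α).submatrix s t) ε) := by
  have hl1 : (1 : ℝ) ≤ √l := Real.one_le_sqrt.2 (by exact_mod_cast hl)
  rw [estimateLaw, PMF.toOuterMeasure_map_apply]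
  refine ofReal_one_sub_le_toOuterMeasure _ _ ?_
  have hset : estimate s F B σ ⁻¹' accurate ((pprMatrix G α).submatrix s t) ε
      = {m : Fin w → V × V | opNorm ((rMatrix F)ᵀ * pprMatrix G α * rMatrix B
          - (1 / (w : ℝ)) • ∑ i, sampleMatrix F B σ (m i))
          ≤ ε * max (opNorm ((pprMatrix G α).submatrix s t)) 1} := by
    ext m
    simp only [Set.mem_preimage, accurate, Set.mem_ofPred_eq, sub_estimate hF hB]
  rw [hset]
  have hx : ∀ (m : V × V) i, 0 ≤ (F i).r m.1 / σ m.1 := fun m i =>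
    div_nonneg ((hF i).r_nonneg _) (hσ.1 _)
  have hy : ∀ (m : V × V) j, 0 ≤ (B j).r m.2 := fun m j => (hB j).r_nonneg _
  have hA : ∀ i j, mean (sampleWalk G hout α hα0 hα1 hσ.toPMF)
      (fun m => (F i).r m.1 / σ m.1 * (B j).r m.2) ≤ (pprMatrix G α).submatrix s t i j := by
    intro i j
    refine le_trans (le_of_eq ?_) (residual_le_submatrix hF hB i j)
    rw [← mean_sampleMatrix hα0 hα1 hout hσ hσF]
    simp only [sampleMatrix_apply]
  have hmono : ∀ (A : Matrix (Fin l) (Fin l) ℝ) (a : Fin l → ℝ),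
      L * √l * opNorm A * (a ⬝ᵥ a) ≤ L * √l * max (opNorm A) 1 * (a ⬝ᵥ a) := fun A a =>
    mul_le_mul_of_nonneg_right (mul_le_mul_of_nonneg_left (le_max_left _ _) (by positivity))
      (zero_le_dotProduct_self a)
  -- As `1 ≤ √l`, the single constant `K = L √l` serves for both the uniform bound and the second
  -- moment.
  have hLK : L ^ 2 ≤ (L * √l) ^ 2 :=
    pow_le_pow_left₀ hL0.le (le_mul_of_one_le_right hL0.le hl1) 2
  refine mean_iid_empirical_le _ (mean_sampleMatrix hα0 hα1 hout hσ hσF) (K := L * √l)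
    (by positivity) (le_max_right _ _) hε hp0 hl (fun m a => ?_) (fun a => ?_) (fun a => ?_) hw hwL
  · rw [sampleMatrix_eq_vecMulVec]
    exact (vecMulVec_sq_le (hL _ _)).trans
      (mul_le_mul_of_nonneg_right hLK (zero_le_dotProduct_self a))
  · simp only [sampleMatrix_eq_vecMulVec]
    exact (mean_vecMulVec_sq_le _ hL0.le hx hy (fun m => hL _ _) hA a).trans (hmono _ a)
  · simp only [sampleMatrix_eq_vecMulVec, transpose_vecMulVec]
    have hT : opNorm ((pprMatrix G α).submatrix s t)ᵀ = opNorm ((pprMatrix G α).submatrix s t) := by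
      have : ∀ A : Matrix (Fin l) (Fin l) ℝ, toEuclideanCLM (𝕜 := ℝ) Aᵀ
          = star (toEuclideanCLM (𝕜 := ℝ) A) := fun A => by
        rw [← map_star, star_eq_conjTranspose, conjTranspose_eq_transpose_of_trivial]
      rw [opNorm, this, ContinuousLinearMap.star_eq_adjoint, LinearIsometryEquiv.norm_map, ← opNorm]
    rw [← hT]
    refine (mean_vecMulVec_sq_le _ hL0.le hy hx (fun m => ?_)
      (A := ((pprMatrix G α).submatrix s t)ᵀ) (fun i j => ?_) a).trans (hmono _ a)
    · rw [mul_comm]; exact hL _ _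
    · simp only [mul_comm ((B i).r _)]
      exact hA j i

/-- If `Π(S,T) = 0`, the estimate is exact. -/
theorem le_estimateLaw_accurate_of_eq_zero (hα0 : 0 < α) (hα1 : α < 1)
    (hout : ∀ v, 0 < outDeg G v) {s t : Fin l → V} {F B : Fin l → DPState V}
    (hF : ∀ i, ForwardInv G α (s i) (F i)) (hB : ∀ i, BackwardInv G α (t i) (B i)) {σ : V → ℝ}
    (hσ : IsDist σ) (hσF : ∀ i v, σ v = 0 → (F i).r v = 0)
    (hzero : (pprMatrix G α).submatrix s t = 0) {ε p : ℝ} (hε : 0 < ε) (hp0 : 0 < p) (w : ℕ) :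
    ENNReal.ofReal (1 - p) ≤ (estimateLaw G hout α hα0 hα1 s F B hσ w).toOuterMeasure
      (accurate ((pprMatrix G α).submatrix s t) ε) := by
  set D := sampleWalk G hout α hα0 hα1 hσ.toPMF with hD
  have hX0 : ∀ m i j, 0 ≤ sampleMatrix F B σ m i j := fun m i j => by
    rw [sampleMatrix_apply]
    exact mul_nonneg (div_nonneg ((hF i).r_nonneg _) (hσ.1 _)) ((hB j).r_nonneg _)
  have hmean : ∀ i j, mean D (fun m => sampleMatrix F B σ m i j) = 0 := fun i j => by
    refine le_antisymm ?_ (Finset.sum_nonneg fun m _ =>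
      mul_nonneg ENNReal.toReal_nonneg (hX0 m i j))
    have := residual_le_submatrix hF hB i j
    rw [hzero, ← mean_sampleMatrix hα0 hα1 hout hσ hσF] at this
    exact this
  -- Nonnegative entries of mean zero vanish on the support, hence every sample that can occur is
  -- the zero matrix.
  have hsupp : ∀ m ∈ D.support, sampleMatrix F B σ m = 0 := by
    intro m hm
    ext i j
    have := (Finset.sum_eq_zero_iff_of_nonneg fun m _ =>
      mul_nonneg ENNReal.toReal_nonneg (hX0 m i j)).1 (hmean i j) m (Finset.mem_univ m)
    refine (mul_eq_zero.1 this).resolve_left ?_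
    exact ENNReal.toReal_ne_zero.2 ⟨hm, D.apply_ne_top m⟩
  have hM : (rMatrix F)ᵀ * pprMatrix G α * rMatrix B = 0 := by
    ext i j
    rw [← mean_sampleMatrix hα0 hα1 hout hσ hσF]
    exact hmean i j
  have h1 : (estimateLaw G hout α hα0 hα1 s F B hσ w).toOuterMeasure
      (accurate ((pprMatrix G α).submatrix s t) ε) = 1 := by
    rw [estimateLaw, PMF.toOuterMeasure_map_apply, PMF.toOuterMeasure_apply_eq_one_iff]
    intro m hm
    have hz : ∀ i, sampleMatrix F B σ (m i) = 0 := fun i =>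
      hsupp _ (mem_support_of_mem_support_iid hm i)
    simp only [Set.mem_preimage, accurate, Set.mem_ofPred_eq, sub_estimate hF hB, hM, hz]
    simp only [Finset.sum_const_zero, smul_zero, sub_zero]
    rw [opNorm, map_zero, norm_zero]
    positivity
  rw [h1]
  exact ENNReal.ofReal_le_one.2 (by linarith)

theorem dotProduct_self_le_of_le {y : Fin l → ℝ} {c : ℝ} (hy : ∀ j, 0 ≤ y j)
    (hc : ∀ j, y j ≤ c) : y ⬝ᵥ y ≤ l * c ^ 2 := by
  calc y ⬝ᵥ y ≤ ∑ _j : Fin l, c ^ 2 := Finset.sum_le_sum fun j _ => by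
        rw [← sq]; exact pow_le_pow_left₀ (hy j) (hc j) 2
    _ = l * c ^ 2 := by simp

theorem IsBackwardOutput.r_le {rt : ℝ} {t : Fin l → V} {B : Fin l → DPState V} {i : Fin l}
    (h : IsBackwardOutput G α rt t B i) (v : V) : (B i).r v ≤ rt :=
  (le_abs_self _).trans ((norm_le_pi_norm (B i).r v).trans (not_lt.1 h.2))

theorem IsForwardOutput.r_le {rs : ℝ} {s : V} {F : Fin l → DPState V} {i : Fin l}
    (h : IsForwardOutput G α rs s (F i)) (hF : (∀ v, 0 ≤ (F i).r v) ∧ 0 < ∑ v, (F i).r v) (v : V) :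
    (F i).r v ≤ rs * sigmaMatrix F i v := by
  have h1 : ∑ u, |(F i).r u| ≤ rs := not_lt.1 h.2
  have h2 : 0 < ∑ u, |(F i).r u| := lt_of_lt_of_le hF.2 (Finset.sum_le_sum fun u _ => le_abs_self _)
  rw [sigmaMatrix, of_apply, mul_div_assoc', le_div_iff₀ h2, mul_comm]
  exact mul_le_mul_of_nonneg_right h1 (hF.1 v)

theorem sigmaMatrix_le_iSup {V : Type*} [Fintype V] (F : Fin l → DPState V) (i : Fin l) (v : V) :
    sigmaMatrix F i v ≤ ⨆ i, sigmaMatrix F i v :=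
  le_ciSup (f := fun i => sigmaMatrix F i v) (Set.finite_range _).bddAbove i

theorem sigmaNorm_pos (hl : 0 < l) {F : Fin l → DPState V}
    (hF : ∀ i, (∀ v, 0 ≤ (F i).r v) ∧ 0 < ∑ v, (F i).r v) : 0 < sigmaNorm F := by
  have h : ∑ v, sigmaMatrix F ⟨0, hl⟩ v ≤ sigmaNorm F :=
    Finset.sum_le_sum fun v _ => sigmaMatrix_le_iSup F _ v
  rw [(sigmaMatrix_isDist hF ⟨0, hl⟩).2] at h
  linarith

end Estimate

end PPR

/-! ### The two start distributions -/

theorem mainTheorem1 {V : Type*} [Fintype V] [DecidableEq V]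
    (G : Digraph V) [DecidableRel G.Adj]
    (hout : ∀ v, 0 < PPR.outDeg G v) (hloop : ∀ v, ¬ G.Adj v v)
    (α : ℝ) (hα0 : 0 < α) (hα1 : α < 1)
    {l : ℕ} (hl : 0 < l) (s t : Fin l ↪ V)
    (rs rt : ℝ) (hrs : 0 < rs) (hrt : 0 < rt)
    (ε : ℝ) (hε : 0 < ε) (p : ℝ) (hp0 : 0 < p) (hp1 : p < 1) :
    -- the dynamic programs always terminate
    ((∀ i, PPR.WhileTerminates (PPR.ForwardGuard rs) (PPR.ForwardBody G α)
        (PPR.DPState.init (s i))) ∧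
      (∀ (B : Fin l → PPR.DPState V) (i : Fin l),
        (∀ j < i, PPR.IsBackwardOutput G α rt t B j) →
        PPR.WhileTerminates (PPR.BackwardGuard rt) (PPR.BackwardBody G α t B i)
          (PPR.DPState.init (t i)))) ∧
    -- for all results `F` and `B` that they can return, and every number `w` of walks
    ∀ (F B : Fin l → PPR.DPState V)
      (hF : ∀ i, PPR.IsForwardOutput G α rs (s i) (F i)),
      (∀ i, PPR.IsBackwardOutput G α rt t B i) →
      ∀ w : ℕ, 0 < w →
        ((l : ℝ) ^ 2 * √(PPR.srank ((PPR.pprMatrix G α).submatrix s t)) * Real.log (2 * l / p)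
              * rs * rt * (6 + 4 * ε) / (3 * ε ^ 2) ≤ w →
            ENNReal.ofReal (1 - p) ≤
              (PPR.estimateLaw G hout α hα0 hα1 s F B
                (PPR.sigmaAvg_isDist hl fun i => (hF i).pos hα1 hout hloop) w).toOuterMeasure
                (PPR.accurate ((PPR.pprMatrix G α).submatrix s t) ε)) ∧
        ((l : ℝ) ^ (3 / 2 : ℝ) * PPR.sigmaNorm F * Real.log (2 * l / p)
              * rs * rt * (6 + 4 * ε) / (3 * ε ^ 2) ≤ w →
            ENNReal.ofReal (1 - p) ≤
              (PPR.estimateLaw G hout α hα0 hα1 s F B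
                (PPR.sigmaMax_isDist hl fun i => (hF i).pos hα1 hout hloop) w).toOuterMeasure
                (PPR.accurate ((PPR.pprMatrix G α).submatrix s t) ε)) := by
  refine ⟨⟨fun i => PPR.forward_terminates hα0 hα1 hout hloop hrs (s i), fun B i hB =>
    PPR.backward_terminates hα0 hα1 hout hloop hrt t B i hB⟩, fun F B hF hB w hw => ?_⟩
  have hFpos := fun i => (hF i).pos hα1 hout hloop
  have hFinv := fun i => (hF i).inv hα0 hα1 hout hloop
  have hBinv : ∀ i, PPR.BackwardInv G α (t i) (B i) := fun i =>
    (PPR.IsBackwardOutput.inv hα0 hα1 hout hloop t i fun j _ => hB j).1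
  have hl' : (0 : ℝ) < l := by exact_mod_cast hl
  have hl1 : (1 : ℝ) ≤ l := by exact_mod_cast hl
  have hSdist := PPR.sigmaMatrix_isDist hFpos
  have hrS : ∀ i v, (F i).r v ≤ rs * PPR.sigmaMatrix F i v := fun i v =>
    (hF i).r_le (hFpos i) v
  have hr0 : ∀ i v, PPR.sigmaMatrix F i v = 0 → (F i).r v = 0 := fun i v h =>
    le_antisymm (by simpa [h] using hrS i v) ((hFpos i).1 v)
  have hyy : ∀ u, (fun j => (B j).r u) ⬝ᵥ (fun j => (B j).r u) ≤ l * rt ^ 2 := fun u =>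
    PPR.dotProduct_self_le_of_le (fun j => (hBinv j).r_nonneg u) fun j => (hB j).r_le u
  have hlog : 0 ≤ Real.log (2 * l / p) := by
    refine Real.log_nonneg ?_
    rw [one_le_div hp0]
    linarith
  have hsq : √(l : ℝ) * √l = l := Real.mul_self_sqrt hl'.le
  constructor
  · intro hwK
    have hdist := PPR.sigmaAvg_isDist hl hFpos
    have hσF : ∀ i v, PPR.sigmaAvg F v = 0 → (F i).r v = 0 := by
      intro i v h
      refine hr0 i v ?_
      have h2 := (mul_eq_zero.1 h).resolve_left (by positivity)
      exact (Finset.sum_eq_zero_iff_of_nonneg fun i _ => (hSdist i).1 v).1 h2 i (Finset.mem_univ i)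
    -- For the zero matrix the stable rank is `0` and the condition on `w` is empty, so this case
    -- needs the exactness argument.
    by_cases hzero : (PPR.pprMatrix G α).submatrix s t = 0
    · exact PPR.le_estimateLaw_accurate_of_eq_zero hα0 hα1 hout hFinv hBinv _ hσF hzero hε hp0 w
    -- The left vector is nonnegative with entries summing to at most `l rs`, since `∑ᵢ σᵢ(v) = l
    -- σ_avg(v)`; hence its norm is at most `l rs`. The right vector has norm at most `√l rt`.
    refine PPR.le_estimateLaw_accurate hα0 hα1 hout hl hFinv hBinv _ hσF
      (L := l * √l * rs * rt) (by positivity) (fun v u => ?_) hε hp0 hw (le_trans ?_ hwK)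
    · have hx0 : ∀ i, 0 ≤ (F i).r v / PPR.sigmaAvg F v := fun i =>
        div_nonneg ((hFpos i).1 v) (hdist.1 v)
      have hsum : ∑ i, (F i).r v / PPR.sigmaAvg F v ≤ l * rs := by
        rw [← Finset.sum_div]
        refine div_le_of_le_mul₀ (hdist.1 v) (by positivity) ?_
        refine (Finset.sum_le_sum fun i _ => hrS i v).trans (le_of_eq ?_)
        rw [← Finset.mul_sum, PPR.sigmaAvg]
        field_simp
      have hxx : (fun i => (F i).r v / PPR.sigmaAvg F v) ⬝ᵥ
          (fun i => (F i).r v / PPR.sigmaAvg F v) ≤ (l * rs) ^ 2 :=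
        (Real.sqrt_le_left (by positivity)).1
          ((PPR.sqrt_dotProduct_self_le_sum hx0).trans hsum)
      refine (mul_le_mul hxx (hyy u) (PPR.zero_le_dotProduct_self _) (by positivity)).trans
        (le_of_eq ?_)
      calc (l * rs) ^ 2 * (l * rt ^ 2) = (l * rs) ^ 2 * ((√l * √l) * rt ^ 2) := by rw [hsq]
        _ = _ := by ring
    · refine div_le_div_of_nonneg_right ?_ (by positivity)
      -- The bound obtained is `l² rs rt` without the stable rank; inserting the factor `√srank ≥ 1`
      -- only enlarges the threshold.
      have h1 := PPR.one_le_sqrt_srank hzero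
      have h2 : 0 ≤ (l : ℝ) ^ 2 * Real.log (2 * l / p) * rs * rt * (6 + 4 * ε) := by positivity
      have h3 := mul_le_mul_of_nonneg_left h1 h2
      calc l * √l * rs * rt * √l * Real.log (2 * l / p) * (6 + 4 * ε)
          = l * (√l * √l) * Real.log (2 * l / p) * rs * rt * (6 + 4 * ε) := by ring
        _ = (l : ℝ) ^ 2 * Real.log (2 * l / p) * rs * rt * (6 + 4 * ε) * 1 := by rw [hsq]; ring
        _ ≤ _ := h3
        _ = _ := by ring
  · intro hwK
    have hdist := PPR.sigmaMax_isDist hl hFpos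
    have hN := PPR.sigmaNorm_pos hl hFpos
    have hσF : ∀ i v, PPR.sigmaMax F v = 0 → (F i).r v = 0 := by
      intro i v h
      refine hr0 i v (le_antisymm ?_ ((hSdist i).1 v))
      have h2 := (mul_eq_zero.1 h).resolve_left (by positivity)
      exact (PPR.sigmaMatrix_le_iSup F i v).trans h2.le
    -- Here each entry of the left vector is at most `rs ‖Σ‖_{∞,1}`, so both vectors contribute a
    -- factor `√l` to `L`.
    refine PPR.le_estimateLaw_accurate hα0 hα1 hout hl hFinv hBinv _ hσF
      (L := l * rs * rt * PPR.sigmaNorm F) (by positivity) (fun v u => ?_) hε hp0 hw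
      (le_trans (le_of_eq ?_) hwK)
    · have hx0 : ∀ i, 0 ≤ (F i).r v / PPR.sigmaMax F v := fun i =>
        div_nonneg ((hFpos i).1 v) (hdist.1 v)
      have hx1 : ∀ i, (F i).r v / PPR.sigmaMax F v ≤ rs * PPR.sigmaNorm F := fun i => by
        refine div_le_of_le_mul₀ (hdist.1 v) (by positivity) ?_
        refine (hrS i v).trans ((mul_le_mul_of_nonneg_left
          (PPR.sigmaMatrix_le_iSup F i v) hrs.le).trans (le_of_eq ?_))
        rw [PPR.sigmaMax]
        field_simp
      refine (mul_le_mul (PPR.dotProduct_self_le_of_le hx0 hx1) (hyy u)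
        (PPR.zero_le_dotProduct_self _) (by positivity)).trans (le_of_eq ?_)
      ring
    · have h32 : (l : ℝ) ^ (3 / 2 : ℝ) = l * √l := by
        rw [Real.sqrt_eq_rpow, show (3 / 2 : ℝ) = 1 + 1 / 2 by norm_num, Real.rpow_add hl',
          Real.rpow_one]
      rw [h32]
      ring
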